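/- Let $M$ be a smooth manifold of dimension $2n+s$ with a metric $f$-structure $(\phi,\xi_i,\eta_j,g)$, $i,j\in\{1,\dots,s\}$ (with $s=0$ allowed, in which case all terms with $\xi_i,\eta_i$ are absent). That is: $\phi$ is a nowhere vanishing smooth field of endomorphisms of $TM$ with $\phi^3+\phi=0$ and constant rank $2n$; $\xi_1,\dots,\xi_s$ are smooth vector fields and $\eta_1,\dots,\eta_s$ smooth 1-forms with $$\ker\phi=\langle\xi_1,\dots,\xi_s\rangle,\quad \eta_i(\xi_j)=\delta_{ij},\quad \eta_i\circ\phi=0,\quad \phi^2=-\mathrm{Id}+\sum_{i=1}^s\eta_i\otimes\xi_i;$$ and $g$ is a Riemannian metric with $g(\phi X,\phi Y)=g(X,Y)-\sum_{i=1}^s\eta_i(X)\eta_i(Y)$. For a 1-form $\alpha$ and a 2-form $\Phi$ put $\mathrm d\alpha(X,Y)=X\alpha(Y)-Y\alpha(X)-\alpha([X,Y])$ and $\mathrm d\Phi(X,Y,Z)=X\Phi(Y,Z)+Y\Phi(Z,X)+Z\Phi(X,Y)-\Phi([X,Y],Z)-\Phi([Z,X],Y)-\Phi([Y,Z],X)$,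 and $(\alpha\wedge\Phi)(X,Y,Z)=\alpha(X)\Phi(Y,Z)-\alpha(Y)\Phi(X,Z)+\alpha(Z)\Phi(X,Y)$. Let $F(X,Y)=g(X,\phi Y)$ be the fundamental 2-form and $\mathrm d^{\phi}F(X,Y,Z)=-\mathrm dF(\phi X,\phi Y,\phi Z)$. The structure is normal if $N^{(1)}=0$, where $$N^{(1)}(X,Y)=[\phi X,\phi Y]+\phi^2[X,Y]-\phi[X,\phi Y]-\phi[\phi X,Y]+\sum_{i=1}^s\mathrm d\eta_i(X,Y)\,\xi_i ,$$ and $M$ is a $\mathcal K$-manifold if it is normal and $\mathrm dF=0$. An almost metric $\phi$-connection with skew-torsion is an affine connection $\nabla$ on $M$ with $\nabla g=0$, $\nabla\phi=0$, $\nabla\xi_i=0$ and $\nabla\eta_i=0$ for all $i$, whose torsion $T(X,Y)=\nabla_XY-\nabla_YX-[X,Y]$ is such that $T(X,Y,Z):=g(T(X,Y),Z)$ is a 3-form. (1) Suppose that $M$ is normal. Then $M$ admits a unique almost metric $\phi$-connection with skew-torsion if and only if every $\xi_i$ is a Killing vector field of $g$. Moreover, the torsion 3-form of any almost metric $\phi$-connection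 with skew-torsion on $M$ is $$T=\sum_{i=1}^s\eta_i\wedge\mathrm d\eta_i+\mathrm d^{\phi}F .$$ (2) Suppose that $M$ is a $\mathcal K$-manifold with $s\ge1$. Then $M$ admits a unique almost metric $\phi$-connection $\nabla$ with skew-torsion, and with $\nabla^g$ the Levi-Civita connection of $g$ it is given by $$\nabla=\nabla^g+\tfrac12\sum_{j=1}^s\eta_j\wedge\mathrm d\eta_j ,\quad\text{i.e.}\quad g(\nabla_XY,Z)=g(\nabla^g_XY,Z)+\tfrac12\sum_{j=1}^s(\eta_j\wedge\mathrm d\eta_j)(X,Y,Z).$$ -/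

import Mathlib

open Bundle VectorField
open scoped Manifold ContDiff

noncomputable section

namespace MetricF

section Structures

variable {E : Type*} [NormedAddCommGroup E] [NormedSpace ℝ E]
  {H : Type*} [TopologicalSpace H] (I : ModelWithCorners ℝ E H)
  (M : Type*) [TopologicalSpace M] [ChartedSpace H M] [IsManifold I ∞ M]

/-- A globally framed `f`-structure `(φ, ξ_i, η_j)` on a smooth manifold `M` of dimension `2n + s`:
a nowhere vanishing smooth field `φ` of endomorphisms of `TM` with `φ³ + φ = 0` and constant rank
`2n`, together with smooth vector fields `ξ_1, …, ξ_s` and smooth 1-forms `η_1, …, η_s` such that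
`Ker φ = ⟨ξ_1, …, ξ_s⟩`, `η_i(ξ_j) = δ_ij`, `η_i ∘ φ = 0` and `φ² = -Id + ∑ η_i ⊗ ξ_i`. -/
structure GloballyFramedFStructure (n s : ℕ) where
  phi : ∀ x : M, TangentSpace I x →L[ℝ] TangentSpace I x
  xi : Fin s → ∀ x : M, TangentSpace I x
  eta : Fin s → ∀ x : M, TangentSpace I x →L[ℝ] ℝ
  contMDiff_phi : ContMDiff I (I.prod 𝓘(ℝ, E →L[ℝ] E)) ∞
    (fun x : M ↦ TotalSpace.mk' (E →L[ℝ] E)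
      (E := fun x : M ↦ TangentSpace I x →L[ℝ] TangentSpace I x) x (phi x))
  contMDiff_xi : ∀ i, ContMDiff I I.tangent ∞
    (fun x : M ↦ (⟨x, xi i x⟩ : TangentBundle I M))
  contMDiff_eta : ∀ i, ContMDiff I (I.prod 𝓘(ℝ, E →L[ℝ] ℝ)) ∞
    (fun x : M ↦ TotalSpace.mk' (E →L[ℝ] ℝ)
      (E := fun x : M ↦ TangentSpace I x →L[ℝ] Bundle.Trivial M ℝ x) x (eta i x))
  dim_eq : Module.finrank ℝ E = 2 * n + s
  phi_ne_zero : ∀ x, phi x ≠ 0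
  phi_cube : ∀ (x : M) (v : TangentSpace I x), phi x (phi x (phi x v)) + phi x v = 0
  rank_phi : ∀ x : M, Module.finrank ℝ (phi x).range = 2 * n
  ker_phi : ∀ x : M, (phi x).ker = Submodule.span ℝ (Set.range fun i ↦ xi i x)
  eta_xi : ∀ (i j : Fin s) (x : M), eta i x (xi j x) = if i = j then 1 else 0
  eta_phi : ∀ (i : Fin s) (x : M) (v : TangentSpace I x), eta i x (phi x v) = 0
  phi_sq : ∀ (x : M) (v : TangentSpace I x),
    phi x (phi x v) = -v + ∑ i, eta i x v • xi i x

/-- A metric `f`-structure `(φ, ξ_i, η_j, g)`: a globally framed `f`-structure with a smooth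
Riemannian metric `g` such that `g(φX, φY) = g(X, Y) - ∑ η_i(X) η_i(Y)`. -/
structure MetricFStructure (n s : ℕ) extends GloballyFramedFStructure I M n s where
  g : ContMDiffRiemannianMetric I ∞ E (fun x : M ↦ TangentSpace I x)
  g_phi_phi : ∀ (x : M) (v w : TangentSpace I x),
    g.inner x (phi x v) (phi x w) = g.inner x v w - ∑ i, eta i x v * eta i x w

end Structures

section Forms

/-! Exterior derivatives and the Nijenhuis tensor are given by their values on vector fields.
The value of each of them at a point `x` makes sense as soon as the vector fields are
differentiable at `x`, and then depends only on the values of the vector fields at `x`. -/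

variable {E : Type*} [NormedAddCommGroup E] [NormedSpace ℝ E]
  {H : Type*} [TopologicalSpace H] {I : ModelWithCorners ℝ E H}
  {M : Type*} [TopologicalSpace M] [ChartedSpace H M]

/-- `dα(X, Y) = X α(Y) - Y α(X) - α([X, Y])` for a 1-form `α`. -/
def extDerivOne (α : ∀ x : M, TangentSpace I x →L[ℝ] ℝ) (X Y : ∀ x : M, TangentSpace I x)
    (x : M) : ℝ :=
  mvfderiv I (fun y ↦ α y (Y y)) x (X x) - mvfderiv I (fun y ↦ α y (X y)) x (Y x)
    - α x (mlieBracket I X Y x)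

/-- `dΦ(X, Y, Z) = X Φ(Y, Z) + Y Φ(Z, X) + Z Φ(X, Y) - Φ([X, Y], Z) - Φ([Z, X], Y) - Φ([Y, Z], X)`
for a 2-form `Φ`. -/
def extDerivTwo (Φ : ∀ x : M, TangentSpace I x → TangentSpace I x → ℝ)
    (X Y Z : ∀ x : M, TangentSpace I x) (x : M) : ℝ :=
  mvfderiv I (fun y ↦ Φ y (Y y) (Z y)) x (X x)
    + mvfderiv I (fun y ↦ Φ y (Z y) (X y)) x (Y x)
    + mvfderiv I (fun y ↦ Φ y (X y) (Y y)) x (Z x)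
    - Φ x (mlieBracket I X Y x) (Z x)
    - Φ x (mlieBracket I Z X x) (Y x)
    - Φ x (mlieBracket I Y Z x) (X x)

/-- `(α ∧ dα)(X, Y, Z) = α(X) dα(Y, Z) - α(Y) dα(X, Z) + α(Z) dα(X, Y)` for a 1-form `α`. -/
def wedgeExtDeriv (α : ∀ x : M, TangentSpace I x →L[ℝ] ℝ) (X Y Z : ∀ x : M, TangentSpace I x)
    (x : M) : ℝ :=
  α x (X x) * extDerivOne α Y Z x - α x (Y x) * extDerivOne α X Z x
    + α x (Z x) * extDerivOne α X Y x

end Forms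

namespace GloballyFramedFStructure

variable {E : Type*} [NormedAddCommGroup E] [NormedSpace ℝ E]
  {H : Type*} [TopologicalSpace H] {I : ModelWithCorners ℝ E H}
  {M : Type*} [TopologicalSpace M] [ChartedSpace H M] [IsManifold I ∞ M] {n s : ℕ}
  (S : GloballyFramedFStructure I M n s)

/-- The vector field `φX`. -/
def phiField (X : ∀ x : M, TangentSpace I x) (x : M) : TangentSpace I x := S.phi x (X x)

/-- The Nijenhuis tensor `N⁽¹⁾(X, Y) = N_φ(X, Y) + ∑ dη_i(X, Y) ξ_i`, where
`N_φ(X, Y) = [φX, φY] + φ²[X, Y] - φ[X, φY] - φ[φX, Y]`. -/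
def nijenhuis (X Y : ∀ x : M, TangentSpace I x) (x : M) : TangentSpace I x :=
  mlieBracket I (S.phiField X) (S.phiField Y) x
    + S.phi x (S.phi x (mlieBracket I X Y x))
    - S.phi x (mlieBracket I X (S.phiField Y) x)
    - S.phi x (mlieBracket I (S.phiField X) Y x)
    + ∑ i, extDerivOne (S.eta i) X Y x • S.xi i x

/-- The structure is normal: `N⁽¹⁾ = 0`. -/
def IsNormal : Prop :=
  ∀ (x : M) (X Y : ∀ x : M, TangentSpace I x),
    MDiffAt (T% X) x → MDiffAt (T% Y) x → S.nijenhuis X Y x = 0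

end GloballyFramedFStructure

section Connections

variable {E : Type*} [NormedAddCommGroup E] [NormedSpace ℝ E]
  {H : Type*} [TopologicalSpace H] {I : ModelWithCorners ℝ E H}
  {M : Type*} [TopologicalSpace M] [ChartedSpace H M] [IsManifold I ∞ M]

/-- `X` is a Killing vector field: `L_X g = 0`, that is,
`X g(Y, Z) = g([X, Y], Z) + g(Y, [X, Z])`. -/
def IsKilling (g : ContMDiffRiemannianMetric I ∞ E (fun x : M ↦ TangentSpace I x))
    (X : ∀ x : M, TangentSpace I x) : Prop :=
  ∀ (x : M) (Y Z : ∀ x : M, TangentSpace I x), MDiffAt (T% Y) x → MDiffAt (T% Z) x →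
    mvfderiv I (fun y ↦ g.inner y (Y y) (Z y)) x (X x)
      = g.inner x (mlieBracket I X Y x) (Z x) + g.inner x (Y x) (mlieBracket I X Z x)

/-- `∇g = 0`. In Mathlib's convention `cov Y x v` is `∇_v Y` at `x`. -/
def IsMetricConnection (g : ContMDiffRiemannianMetric I ∞ E (fun x : M ↦ TangentSpace I x))
    (cov : CovariantDerivative I E (fun x : M ↦ TangentSpace I x)) : Prop :=
  ∀ (x : M) (Y Z : ∀ x : M, TangentSpace I x) (v : TangentSpace I x),
    MDiffAt (T% Y) x → MDiffAt (T% Z) x →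
    mvfderiv I (fun y ↦ g.inner y (Y y) (Z y)) x v
      = g.inner x (cov Y x v) (Z x) + g.inner x (Y x) (cov Z x v)

/-- Two connections are the same: they agree on all vector fields, wherever these are
differentiable. (A `CovariantDerivative` has arbitrary values elsewhere.) -/
def SameConnection (cov cov' : CovariantDerivative I E (fun x : M ↦ TangentSpace I x)) : Prop :=
  ∀ (x : M) (Y : ∀ x : M, TangentSpace I x), MDiffAt (T% Y) x → cov Y x = cov' Y x

variable [FiniteDimensional ℝ E]

/-- The Levi-Civita connection of `g`: the smooth torsion-free connection with `∇g = 0`. -/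
structure IsLeviCivita (g : ContMDiffRiemannianMetric I ∞ E (fun x : M ↦ TangentSpace I x))
    (cov : CovariantDerivative I E (fun x : M ↦ TangentSpace I x)) : Prop where
  smooth : CovariantDerivative.ContMDiffCovariantDerivative cov ∞
  metric : IsMetricConnection g cov
  torsion_eq_zero : cov.torsion = 0

/-- `∇` has totally skew-symmetric torsion: `T(X, Y, Z) = g(T(X, Y), Z)` is a 3-form. -/
def HasSkewTorsion (g : ContMDiffRiemannianMetric I ∞ E (fun x : M ↦ TangentSpace I x))
    (cov : CovariantDerivative I E (fun x : M ↦ TangentSpace I x)) : Prop :=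
  ∀ (x : M) (u v w : TangentSpace I x),
    g.inner x (cov.torsion x u v) w = -g.inner x (cov.torsion x v u) w ∧
    g.inner x (cov.torsion x u v) w = -g.inner x (cov.torsion x u w) v

end Connections

namespace MetricFStructure

variable {E : Type*} [NormedAddCommGroup E] [NormedSpace ℝ E]
  {H : Type*} [TopologicalSpace H] {I : ModelWithCorners ℝ E H}
  {M : Type*} [TopologicalSpace M] [ChartedSpace H M] [IsManifold I ∞ M] {n s : ℕ}
  (S : MetricFStructure I M n s)

/-- The fundamental 2-form `F(X, Y) = g(X, φY)`. -/
def fundForm (x : M) (v w : TangentSpace I x) : ℝ := S.g.inner x v (S.phi x w)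

/-- `d^φ F(X, Y, Z) = -dF(φX, φY, φZ)`. -/
def dPhiFundForm (X Y Z : ∀ x : M, TangentSpace I x) (x : M) : ℝ :=
  -extDerivTwo S.fundForm (S.phiField X) (S.phiField Y) (S.phiField Z) x

/-- A `K`-structure: a normal metric `f`-structure with `dF = 0`. -/
structure IsKStructure : Prop where
  normal : S.IsNormal
  closed : ∀ (x : M) (X Y Z : ∀ x : M, TangentSpace I x),
    MDiffAt (T% X) x → MDiffAt (T% Y) x → MDiffAt (T% Z) x →
    extDerivTwo S.fundForm X Y Z x = 0

/-- An almost metric `φ`-connection: a smooth affine connection with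
`∇g = 0`, `∇φ = 0`, `∇ξ_i = 0` and `∇η_i = 0` for all `i`. -/
structure IsAlmostMetricPhiConnection
    (cov : CovariantDerivative I E (fun x : M ↦ TangentSpace I x)) : Prop where
  smooth : CovariantDerivative.ContMDiffCovariantDerivative cov ∞
  metric : IsMetricConnection S.g cov
  parallel_phi : ∀ (x : M) (Y : ∀ x : M, TangentSpace I x) (v : TangentSpace I x),
    MDiffAt (T% Y) x → cov (S.phiField Y) x v = S.phi x (cov Y x v)
  parallel_xi : ∀ (i : Fin s) (x : M) (v : TangentSpace I x), cov (S.xi i) x v = 0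
  parallel_eta : ∀ (i : Fin s) (x : M) (Y : ∀ x : M, TangentSpace I x) (v : TangentSpace I x),
    MDiffAt (T% Y) x → mvfderiv I (fun y ↦ S.eta i y (Y y)) x v = S.eta i x (cov Y x v)

variable [FiniteDimensional ℝ E]

/-- An almost metric `φ`-connection with skew-torsion. -/
def IsSkewPhiConnection
    (cov : CovariantDerivative I E (fun x : M ↦ TangentSpace I x)) : Prop :=
  S.IsAlmostMetricPhiConnection cov ∧ HasSkewTorsion S.g cov

/-- `cov` is the unique almost metric `φ`-connection with skew-torsion. -/
def IsUniqueSkewPhiConnection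
    (cov : CovariantDerivative I E (fun x : M ↦ TangentSpace I x)) : Prop :=
  S.IsSkewPhiConnection cov ∧
    ∀ cov' : CovariantDerivative I E (fun x : M ↦ TangentSpace I x),
      S.IsSkewPhiConnection cov' → SameConnection cov' cov

end MetricFStructure

end MetricF

end

/-!
A metric connection `∇` with skew-symmetric torsion `T` is `∇^g + T / 2`, so it is determined by its
torsion (`inner_eq_leviCivita_add_torsion`, `sameConnection_of_torsion_eq`). If moreover `∇φ = 0`,
`∇ξ_i = 0` and the structure is normal, then the torsion is forced. Writing brackets by means of `∇`
and `T`, the condition `N⁽¹⁾ = 0` becomes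
`T(X, Y, Z) = T(φX, φY, Z) + T(X, φY, φZ) + T(φX, Y, φZ)`, and the right-hand side is
`∑ η_i ∧ dη_i + d^φ F`, since `η_i ∘ T = dη_i` and `dF` is the cyclic sum of `T(X, Y, φZ)`
(`IsSkewPhiConnection.inner_torsion`). This gives uniqueness and the formula for the torsion. The
`ξ_i` are then Killing, because `(L_{ξ_i} g)(Y, Z) = T(ξ_i, Y, Z) + T(ξ_i, Z, Y) = 0`.

For existence, suppose that the `ξ_i` are Killing, so that `dη_i(X, Y) = 2 g(∇^g_X ξ_i, Y)`. The
connection `∇' = ∇^g + (1/2) ∑ η_i ∧ dη_i` (`frameConnection`) is metric and has parallel `ξ_i`.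
Let `p(u, v, w) = g((∇'_u φ) v, w)`. It is skew-symmetric in `v, w` and vanishes if one of these is
a `ξ_i`, and `p(u, φv, w) = p(u, v, φw)`. The torsion `∑ η_i ∧ dη_i` of `∇'` already has the
symmetry displayed above (`inner_frameCorrection_phi`), hence `N⁽¹⁾ = 0` says that
`r(u, v, w) = p(φu, v, w) + p(u, v, φw)` is symmetric in `u, v`. Being skew-symmetric in `v, w`,
it is zero (`inner_nablaPhi_phi_left`). It follows that adding half of the 3-form
`B(u, v, w) = -(p(φu, v, w) + p(φv, w, u) + p(φw, u, v))` to `∇'` makes `φ` parallel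
(`skewForm_phi_add`) and keeps the `ξ_i` parallel.

On a `K`-manifold the `ξ_i` are Killing, since `L_{ξ_i} F = 0` and `L_{ξ_i} φ = 0`
(`IsKStructure.isKilling`), and `d^φ F = 0`.

Smoothness of connections is checked on the functions `g(∇_X Y, Z)`, and the Levi-Civita connection
is constructed from the Koszul formula.
-/

noncomputable section

open Filter FiberBundle
open scoped Topology

namespace MetricF

/-! ### Smoothness of sections and the musical isomorphism -/

section Smoothness

variable {E : Type*} [NormedAddCommGroup E] [NormedSpace ℝ E]
  {H : Type*} [TopologicalSpace H] {I : ModelWithCorners ℝ E H}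
  {M : Type*} [TopologicalSpace M] [ChartedSpace H M]

instance finiteDimensional_tangentSpace [FiniteDimensional ℝ E] (x : M) :
    FiniteDimensional ℝ (TangentSpace I x) :=
  inferInstanceAs (FiniteDimensional ℝ E)

instance t2Space_tangentSpace (x : M) : T2Space (TangentSpace I x) :=
  inferInstanceAs (T2Space E)

/-- In finite dimension, a family of linear maps is smooth as soon as its evaluations are. -/
lemma contMDiffAt_clm_of_apply [FiniteDimensional ℝ E] {F : Type*} [NormedAddCommGroup F]
    [NormedSpace ℝ F] {f : M → E →L[ℝ] F} {x : M}
    (h : ∀ v, ContMDiffAt I 𝓘(ℝ, F) ∞ (fun y ↦ f y v) x) :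
    ContMDiffAt I 𝓘(ℝ, E →L[ℝ] F) ∞ f x := by
  have hd : Module.finrank ℝ E = Module.finrank ℝ (Fin (Module.finrank ℝ E) → ℝ) :=
    (Module.finrank_fin_fun ℝ).symm
  let e₁ := ContinuousLinearEquiv.ofFinrankEq hd
  let e₂ := (e₁.arrowCongr (1 : F ≃L[ℝ] F)).trans
    (ContinuousLinearEquiv.piRing (Fin (Module.finrank ℝ E)))
  rw [← Function.id_comp f, ← e₂.symm_comp_self]
  refine e₂.symm.contDiff.contMDiff.contMDiffAt.comp (I' := 𝓘(ℝ, Fin (Module.finrank ℝ E) → F))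
    x ?_
  exact contMDiffAt_pi_space.2 fun i ↦ h _

variable [IsManifold I ∞ M]

lemma eventually_mdifferentiableAt {X : ∀ x : M, TangentSpace I x} {x : M}
    (hX : CMDiffAt ∞ (T% X) x) : ∀ᶠ y in 𝓝 x, MDiffAt (T% X) y := by
  have h1 : CMDiffAt 1 (T% X) x := hX.of_le (by norm_cast)
  filter_upwards [(contMDiffAt_iff_contMDiffAt_nhds (by simp)).1 h1] with y hy
  exact hy.mdifferentiableAt one_ne_zero

/-- A field of endomorphisms is smooth at a point if it maps vector fields that are smooth there to
vector fields that are smooth there. -/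
lemma contMDiffAt_hom_of_apply [FiniteDimensional ℝ E]
    {A : ∀ x : M, TangentSpace I x →L[ℝ] TangentSpace I x} {x : M}
    (h : ∀ X : ∀ x : M, TangentSpace I x, CMDiffAt ∞ (T% X) x →
      CMDiffAt ∞ (T% fun y ↦ A y (X y)) x) :
    ContMDiffAt I (I.prod 𝓘(ℝ, E →L[ℝ] E)) ∞
      (fun y : M ↦ TotalSpace.mk' (E →L[ℝ] E)
        (E := fun x : M ↦ TangentSpace I x →L[ℝ] TangentSpace I x) y (A y)) x := by
  rw [contMDiffAt_hom_bundle]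
  refine ⟨contMDiffAt_id, contMDiffAt_clm_of_apply fun v ↦ ?_⟩
  set e := trivializationAt E (TangentSpace I : M → Type _) x with he
  have hx : x ∈ e.baseSet := mem_baseSet_trivializationAt' x
  have key := h (extend E (e.symm x v)) (contMDiffAt_extend I E _)
  rw [contMDiffAt_section] at key
  refine key.congr_of_eventuallyEq ?_
  filter_upwards [e.open_baseSet.mem_nhds hx] with y hy
  simp only [ContinuousLinearMap.inCoordinates, ContinuousLinearMap.comp_apply]
  change e.continuousLinearMapAt ℝ y (A y (e.symmL ℝ y v)) =
    (e ⟨y, A y (e.symm y (e ⟨x, e.symm x v⟩).2)⟩).2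
  rw [e.continuousLinearMapAt_apply_of_mem ℝ hy, e.symmL_apply hy, e.apply_mk_symm hx]

variable (g : ContMDiffRiemannianMetric I ∞ E (fun x : M ↦ TangentSpace I x))

lemma contMDiffAt_inner {X Y : ∀ x : M, TangentSpace I x} {x : M}
    (hX : CMDiffAt ∞ (T% X) x) (hY : CMDiffAt ∞ (T% Y) x) :
    CMDiffAt ∞ (fun y ↦ g.inner y (X y) (Y y)) x := by
  let : RiemannianBundle (fun x : M ↦ TangentSpace I x) := ⟨g.toRiemannianMetric⟩
  exact ContMDiffAt.inner_bundle (F := E) (E := fun x : M ↦ TangentSpace I x) hX hY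

lemma mdifferentiableAt_inner {X Y : ∀ x : M, TangentSpace I x} {x : M}
    (hX : MDiffAt (T% X) x) (hY : MDiffAt (T% Y) x) :
    MDiffAt (fun y ↦ g.inner y (X y) (Y y)) x := by
  let : RiemannianBundle (fun x : M ↦ TangentSpace I x) := ⟨g.toRiemannianMetric⟩
  exact MDifferentiableAt.inner_bundle (F := E) (E := fun x : M ↦ TangentSpace I x) hX hY

lemma contMDiffAt_mvfderiv_apply {f : M → ℝ} {X : ∀ x : M, TangentSpace I x} {x : M}
    (hf : CMDiffAt ∞ f x) (hX : CMDiffAt ∞ (T% X) x) :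
    CMDiffAt ∞ (fun y ↦ mvfderiv I f y (X y)) x := by
  have h1 := hf.mfderiv_const (m := ∞) (by simp)
  have h2 := ContMDiffAt.clm_apply_of_inCoordinates (b₁ := fun y : M ↦ y) (b₂ := f)
    (E₁ := fun x : M ↦ TangentSpace I x) (E₂ := fun r : ℝ ↦ TangentSpace 𝓘(ℝ, ℝ) r)
    (F₁ := E) (F₂ := ℝ) (IB₁ := I) (IB₂ := 𝓘(ℝ, ℝ)) (ϕ := fun y ↦ mfderiv I 𝓘(ℝ, ℝ) f y)
    (v := X) h1 hX hf
  exact (contMDiff_snd_tangentBundle_modelSpace ℝ 𝓘(ℝ, ℝ)).contMDiffAt.comp x h2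

lemma contMDiffAt_mlieBracket [FiniteDimensional ℝ E] {X Y : ∀ x : M, TangentSpace I x} {x : M}
    (hX : CMDiffAt ∞ (T% X) x) (hY : CMDiffAt ∞ (T% Y) x) :
    CMDiffAt ∞ (T% (mlieBracket I X Y)) x := by
  have : IsManifold I (minSmoothness ℝ 2) M := by
    rw [minSmoothness_of_isRCLikeNormedField]; infer_instance
  have : IsManifold I ((⊤ : ℕ∞) + 1 : ℕ∞ω) M := by simpa using ‹IsManifold I ∞ M›
  exact ContMDiffAt.mlieBracket_vectorField (m := ⊤) (n := ⊤) hX hY (by simp)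

lemma inner_self_eq_zero {x : M} {v : TangentSpace I x} (h : g.inner x v v = 0) : v = 0 := by
  by_contra hv
  exact (g.pos x v hv).ne' h

/-- Nondegeneracy of the metric. -/
lemma eq_of_inner_eq {x : M} {v w : TangentSpace I x}
    (h : ∀ u, g.inner x v u = g.inner x w u) : v = w := by
  refine sub_eq_zero.1 (inner_self_eq_zero g ?_)
  rw [map_sub (g.inner x), sub_apply, h, sub_self]

/-- A vector field is smooth at a point if its inner products with all vector fields smooth there
are smooth. -/
lemma contMDiffAt_of_inner [FiniteDimensional ℝ E] {V : ∀ x : M, TangentSpace I x} {x : M}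
    (h : ∀ Z : ∀ x : M, TangentSpace I x, CMDiffAt ∞ (T% Z) x →
      CMDiffAt ∞ (fun y ↦ g.inner y (V y) (Z y)) x) :
    CMDiffAt ∞ (T% V) x := by
  set e := trivializationAt E (TangentSpace I : M → Type _) x with he
  have hx : x ∈ e.baseSet := mem_baseSet_trivializationAt' x
  -- The metric and the covector field `g(V, ·)`, read in the trivialization `e`.
  let G : M → E →L[ℝ] E →L[ℝ] ℝ := fun y ↦
    (ContinuousLinearMap.precomp ℝ (e.symmL ℝ y)).comp ((g.inner y).comp (e.symmL ℝ y))
  let l : M → E →L[ℝ] ℝ := fun y ↦ (g.inner y (V y)).comp (e.symmL ℝ y)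
  have hframe (a : E) : CMDiffAt ∞ (T% (fun y ↦ e.symmL ℝ y a)) x := by
    refine (contMDiffAt_extend I E (e.symm x a)).congr_of_eventuallyEq ?_
    filter_upwards [e.open_baseSet.mem_nhds hx] with y hy
    change (⟨y, e.symmL ℝ y a⟩ : TangentBundle I M) = ⟨y, e.symm y (e ⟨x, e.symm x a⟩).2⟩
    rw [e.symmL_apply hy, e.apply_mk_symm hx]
  have hG : ContMDiffAt I 𝓘(ℝ, E →L[ℝ] E →L[ℝ] ℝ) ∞ G x :=
    contMDiffAt_clm_of_apply fun a ↦ contMDiffAt_clm_of_apply fun b ↦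
      contMDiffAt_inner g (hframe a) (hframe b)
  have hl : ContMDiffAt I 𝓘(ℝ, E →L[ℝ] ℝ) ∞ l x :=
    contMDiffAt_clm_of_apply fun a ↦ h _ (hframe a)
  have hinv {y : M} (hy : y ∈ e.baseSet) :
      ∃ G' : E ≃L[ℝ] E →L[ℝ] ℝ, (G' : E →L[ℝ] E →L[ℝ] ℝ) = G y := by
    have hinj : Function.Injective (G y).toLinearMap := by
      refine (injective_iff_map_eq_zero _).2 fun a ha ↦ ?_
      have h1 : g.inner y (e.symmL ℝ y a) (e.symmL ℝ y a) = 0 :=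
        congr(($ha : E →L[ℝ] ℝ) a)
      have h2 := inner_self_eq_zero g h1
      rw [← e.continuousLinearMapAt_symmL (R := ℝ) hy a, h2, map_zero]
    have hrank : Module.finrank ℝ E = Module.finrank ℝ (E →L[ℝ] ℝ) := by
      rw [← (LinearMap.toContinuousLinearMap (𝕜 := ℝ) (E := E) (F' := ℝ)).finrank_eq]
      exact (Subspace.dual_finrank_eq (K := ℝ) (V := E)).symm
    exact ⟨(LinearMap.linearEquivOfInjective (G y).toLinearMap hinj
      hrank).toContinuousLinearEquiv, by ext; rfl⟩
  obtain ⟨G', hG'⟩ := hinv hx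
  have hGinv : ContMDiffAt I 𝓘(ℝ, (E →L[ℝ] ℝ) →L[ℝ] E) ∞
      (fun y ↦ ContinuousLinearMap.inverse (G y)) x :=
    ContDiffAt.comp_contMDiffAt (x := x) (f := G)
      (by rw [← hG']; exact contDiffAt_map_inverse (n := ∞) G') hG
  rw [contMDiffAt_section]
  refine (hGinv.clm_apply hl).congr_of_eventuallyEq ?_
  filter_upwards [e.open_baseSet.mem_nhds hx] with y hy
  obtain ⟨Gy, hGy⟩ := hinv hy
  have hl' : l y = Gy (e ⟨y, V y⟩).2 := by
    ext a
    change g.inner y (V y) (e.symmL ℝ y a) = (Gy : E →L[ℝ] E →L[ℝ] ℝ) (e ⟨y, V y⟩).2 a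
    rw [hGy]
    change _ = g.inner y (e.symmL ℝ y (e ⟨y, V y⟩).2) (e.symmL ℝ y a)
    rw [← e.continuousLinearMapAt_apply_of_mem ℝ hy, e.symmL_continuousLinearMapAt hy]
  rw [← hGy, hl', ContinuousLinearMap.inverse_equiv]
  simp [he]

/-- A field of endomorphisms `A` is smooth at a point if `g(A X, Z)` is smooth there for all vector
fields `X` and `Z` that are smooth there. -/
lemma contMDiffAt_hom_of_inner [FiniteDimensional ℝ E]
    {A : ∀ x : M, TangentSpace I x →L[ℝ] TangentSpace I x} {x : M}
    (h : ∀ X Z : ∀ x : M, TangentSpace I x, CMDiffAt ∞ (T% X) x → CMDiffAt ∞ (T% Z) x →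
      CMDiffAt ∞ (fun y ↦ g.inner y (A y (X y)) (Z y)) x) :
    ContMDiffAt I (I.prod 𝓘(ℝ, E →L[ℝ] E)) ∞
      (fun y : M ↦ TotalSpace.mk' (E →L[ℝ] E)
        (E := fun x : M ↦ TangentSpace I x →L[ℝ] TangentSpace I x) y (A y)) x :=
  contMDiffAt_hom_of_apply fun X hX ↦ contMDiffAt_of_inner g fun Z hZ ↦ h X Z hX hZ

variable [FiniteDimensional ℝ E]

/-- The musical isomorphism `♯`: the vector that represents a covector with respect to `g`. -/
def sharp (x : M) : (TangentSpace I x →L[ℝ] ℝ) ≃ₗ[ℝ] TangentSpace I x :=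
  ((g.inner x).toLinearMap.linearEquivOfInjective
    ((injective_iff_map_eq_zero _).2 fun v hv ↦ inner_self_eq_zero g congr($hv v))
    (by
      rw [← (LinearMap.toContinuousLinearMap (𝕜 := ℝ) (E := TangentSpace I x)
        (F' := ℝ)).finrank_eq]
      exact (Subspace.dual_finrank_eq (K := ℝ) (V := TangentSpace I x)).symm)).symm

lemma inner_sharp (x : M) (α : TangentSpace I x →L[ℝ] ℝ) (w : TangentSpace I x) :
    g.inner x (sharp g x α) w = α w :=
  congr($(((sharp g x).symm_apply_apply α)) w)

end Smoothness

/-! ### The Levi-Civita connection -/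

section LeviCivita

variable {E : Type*} [NormedAddCommGroup E] [NormedSpace ℝ E]
  {H : Type*} [TopologicalSpace H] {I : ModelWithCorners ℝ E H}
  {M : Type*} [TopologicalSpace M] [ChartedSpace H M] [IsManifold I ∞ M]
  (g : ContMDiffRiemannianMetric I ∞ E (fun x : M ↦ TangentSpace I x))

lemma mvfderiv_inner_comm (X Y : ∀ x : M, TangentSpace I x) :
    mvfderiv I (fun y ↦ g.inner y (X y) (Y y)) = mvfderiv I (fun y ↦ g.inner y (Y y) (X y)) := by
  congr 1
  exact funext fun y ↦ g.symm y _ _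

lemma mvfderiv_inner_add_left {X X' Y : ∀ x : M, TangentSpace I x} {x : M}
    (hX : MDiffAt (T% X) x) (hX' : MDiffAt (T% X') x) (hY : MDiffAt (T% Y) x) :
    mvfderiv I (fun y ↦ g.inner y ((X + X') y) (Y y)) x =
      mvfderiv I (fun y ↦ g.inner y (X y) (Y y)) x +
        mvfderiv I (fun y ↦ g.inner y (X' y) (Y y)) x := by
  rw [← mvfderiv_add (mdifferentiableAt_inner g hX hY) (mdifferentiableAt_inner g hX' hY)]
  congr 1
  ext y
  simp

lemma mvfderiv_inner_smul_left {f : M → ℝ} {X Y : ∀ x : M, TangentSpace I x} {x : M}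
    (hf : MDiffAt f x) (hX : MDiffAt (T% X) x) (hY : MDiffAt (T% Y) x) :
    mvfderiv I (fun y ↦ g.inner y ((f • X) y) (Y y)) x =
      f x • mvfderiv I (fun y ↦ g.inner y (X y) (Y y)) x +
        g.inner x (X x) (Y x) • mvfderiv I f x := by
  rw [← mvfderiv_mul hf (mdifferentiableAt_inner g hX hY)]
  congr 1
  ext y
  simp

/-- Endomorphisms of a tangent space are determined by the inner products `g(A X, Z)` for vector
fields `X` and `Z` differentiable at the base point. -/
lemma endomorphism_ext {x : M} {A A' : TangentSpace I x →L[ℝ] TangentSpace I x}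
    (h : ∀ X Z : ∀ x : M, TangentSpace I x, MDiffAt (T% X) x → MDiffAt (T% Z) x →
      g.inner x (A (X x)) (Z x) = g.inner x (A' (X x)) (Z x)) : A = A' := by
  ext v
  refine eq_of_inner_eq g fun w ↦ ?_
  have := h (extend E v) (extend E w) (mdifferentiableAt_extend ..)
    (mdifferentiableAt_extend ..)
  simpa using this

/-- The Koszul expression; the Levi-Civita connection `D` is characterized by
`2 g(D_X Y, Z) = koszul g X Y Z`. -/
def koszul (X Y Z : ∀ x : M, TangentSpace I x) (x : M) : ℝ :=
  mvfderiv I (fun y ↦ g.inner y (Y y) (Z y)) x (X x)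
    + mvfderiv I (fun y ↦ g.inner y (Z y) (X y)) x (Y x)
    - mvfderiv I (fun y ↦ g.inner y (X y) (Y y)) x (Z x)
    + g.inner x (mlieBracket I X Y x) (Z x)
    - g.inner x (mlieBracket I X Z x) (Y x)
    - g.inner x (mlieBracket I Y Z x) (X x)

variable [FiniteDimensional ℝ E]

lemma tensorialAt_koszul_left {Y Z : ∀ x : M, TangentSpace I x} {x : M}
    (hY : MDiffAt (T% Y) x) (hZ : MDiffAt (T% Z) x) :
    TensorialAt I E (fun X ↦ koszul g X Y Z x) x where
  smul {f X} hf hX := by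
    simp only [koszul, mvfderiv_inner_comm g Z (f • X), mvfderiv_inner_comm g Z X,
      mvfderiv_inner_smul_left g hf hX hY,
      mvfderiv_inner_smul_left g hf hX hZ, mlieBracket_smul_left hf hX]
    simp [g.symm x (X x)]
    ring
  add {X X'} hX hX' := by
    simp only [koszul, mvfderiv_inner_comm g Z (X + X'), mvfderiv_inner_comm g Z X,
      mvfderiv_inner_comm g Z X', mvfderiv_inner_add_left g hX hX' hY,
      mvfderiv_inner_add_left g hX hX' hZ, mlieBracket_add_left hX hX']
    simp
    ring

lemma tensorialAt_koszul_right {X Y : ∀ x : M, TangentSpace I x} {x : M}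
    (hX : MDiffAt (T% X) x) (hY : MDiffAt (T% Y) x) :
    TensorialAt I E (fun Z ↦ koszul g X Y Z x) x where
  smul {f Z} hf hZ := by
    simp only [koszul, mvfderiv_inner_comm g Y (f • Z), mvfderiv_inner_comm g Y Z,
      mvfderiv_inner_smul_left g hf hZ hY,
      mvfderiv_inner_smul_left g hf hZ hX, mlieBracket_smul_right hf hZ]
    simp
    ring
  add {Z Z'} hZ hZ' := by
    simp only [koszul, mvfderiv_inner_comm g Y (Z + Z'), mvfderiv_inner_comm g Y Z,
      mvfderiv_inner_comm g Y Z', mvfderiv_inner_add_left g hZ hZ' hY,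
      mvfderiv_inner_add_left g hZ hZ' hX, mlieBracket_add_right hZ hZ']
    simp
    ring

/-- The bilinear form `(X, Z) ↦ koszul g X Y Z` on the tangent space at a point where the vector
field `Y` is differentiable. -/
def koszulForm {Y : ∀ x : M, TangentSpace I x} {x : M} (hY : MDiffAt (T% Y) x) :
    TangentSpace I x →L[ℝ] TangentSpace I x →L[ℝ] ℝ :=
  TensorialAt.mkHom₂ (F := E) (F' := E) (fun X Z ↦ koszul g X Y Z x) x
    (fun _ hZ ↦ tensorialAt_koszul_left g hY hZ) (fun _ hX ↦ tensorialAt_koszul_right g hX hY)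

lemma koszulForm_apply {X Y Z : ∀ x : M, TangentSpace I x} {x : M} (hX : MDiffAt (T% X) x)
    (hY : MDiffAt (T% Y) x) (hZ : MDiffAt (T% Z) x) :
    koszulForm g hY (X x) (Z x) = koszul g X Y Z x :=
  TensorialAt.mkHom₂_apply _ _ hX hZ

open Classical in
/-- The covariant derivative `X ↦ D_X Y` of the Levi-Civita connection. It is zero at the points
where `Y` is not differentiable. -/
def leviCivitaFun (Y : ∀ x : M, TangentSpace I x) (x : M) :
    TangentSpace I x →L[ℝ] TangentSpace I x :=
  if hY : MDiffAt (T% Y) x then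
    ((1 / 2 : ℝ) • (sharp g x).toLinearMap ∘ₗ
      (ContinuousLinearMap.toLinearMap (koszulForm g hY))).toContinuousLinearMap
  else 0

lemma inner_leviCivitaFun {X Y Z : ∀ x : M, TangentSpace I x} {x : M} (hX : MDiffAt (T% X) x)
    (hY : MDiffAt (T% Y) x) (hZ : MDiffAt (T% Z) x) :
    g.inner x (leviCivitaFun g Y x (X x)) (Z x) = (1 / 2) * koszul g X Y Z x := by
  rw [leviCivitaFun, dif_pos hY]
  simp [inner_sharp, koszulForm_apply g hX hY hZ]

/-- The Levi-Civita connection. -/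
def leviCivita : CovariantDerivative I E (fun x : M ↦ TangentSpace I x) where
  toFun := leviCivitaFun g
  isCovariantDerivativeOnUniv :=
    { add {Y Y' x} hY hY' _ := by
        refine endomorphism_ext g fun X Z hX hZ ↦ ?_
        rw [add_apply, map_add, add_apply, inner_leviCivitaFun g hX hY hZ,
          inner_leviCivitaFun g hX hY' hZ,
          inner_leviCivitaFun g hX (mdifferentiableAt_add_section hY hY') hZ]
        simp only [koszul, mvfderiv_inner_comm g X (Y + Y'), mvfderiv_inner_comm g X Y,
          mvfderiv_inner_comm g X Y', mvfderiv_inner_add_left g hY hY' hX,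
          mvfderiv_inner_add_left g hY hY' hZ, mlieBracket_add_right hY hY',
          mlieBracket_add_left hY hY']
        simp
        ring
      leibniz {Y f x} hY hf _ := by
        refine endomorphism_ext g fun X Z hX hZ ↦ ?_
        rw [add_apply, map_add, add_apply, smul_apply, map_smul, smul_apply,
          inner_leviCivitaFun g hX hY hZ, inner_leviCivitaFun g hX (hf.smul_section hY) hZ]
        simp only [koszul, mvfderiv_inner_comm g X (f • Y), mvfderiv_inner_comm g X Y,
          mvfderiv_inner_smul_left g hf hY hX,
          mvfderiv_inner_smul_left g hf hY hZ, mlieBracket_smul_right hf hY,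
          mlieBracket_smul_left hf hY]
        simp
        ring }

lemma inner_leviCivita {X Y Z : ∀ x : M, TangentSpace I x} {x : M} (hX : MDiffAt (T% X) x)
    (hY : MDiffAt (T% Y) x) (hZ : MDiffAt (T% Z) x) :
    g.inner x (leviCivita g Y x (X x)) (Z x) = (1 / 2) * koszul g X Y Z x :=
  inner_leviCivitaFun g hX hY hZ

lemma isMetricConnection_leviCivita : IsMetricConnection g (leviCivita g) := by
  intro x Y Z v hY hZ
  have hX := mdifferentiableAt_extend I E v
  have h1 := inner_leviCivita g hX hY hZ
  have h2 := inner_leviCivita g hX hZ hY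
  rw [extend_apply_self] at h1 h2
  rw [h1, g.symm x (Y x), h2]
  simp only [koszul, mvfderiv_inner_comm g Z Y, mvfderiv_inner_comm g (extend E v) Y,
    mvfderiv_inner_comm g (extend E v) Z, mlieBracket_swap_apply (V := Z) (W := Y),
    extend_apply_self]
  simp
  ring

lemma torsion_leviCivita : (leviCivita g).torsion = 0 := by
  rw [CovariantDerivative.torsion_eq_zero_iff]
  intro X Y x hX hY
  refine eq_of_inner_eq g fun w ↦ ?_
  have hZ := mdifferentiableAt_extend I E w
  have h1 := inner_leviCivita g hX hY hZ
  have h2 := inner_leviCivita g hY hX hZ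
  rw [extend_apply_self] at h1 h2
  rw [map_sub (g.inner x), sub_apply, h1, h2]
  simp only [koszul, mvfderiv_inner_comm g Y X, mvfderiv_inner_comm g X (extend E w),
    mvfderiv_inner_comm g (extend E w) Y, mlieBracket_swap_apply (V := Y) (W := X),
    extend_apply_self]
  simp
  ring

/-- Pointwise form of smoothness of a connection: `g(∇_X Y, Z)` is smooth at every point where
`X`, `Y` and `Z` are. -/
def IsSmoothConnection (cov : CovariantDerivative I E (fun x : M ↦ TangentSpace I x)) : Prop :=
  ∀ (x : M) (X Y Z : ∀ x : M, TangentSpace I x),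
    CMDiffAt ∞ (T% X) x → CMDiffAt ∞ (T% Y) x → CMDiffAt ∞ (T% Z) x →
      CMDiffAt ∞ (fun y ↦ g.inner y (cov Y y (X y)) (Z y)) x

lemma contMDiffAt_koszul {X Y Z : ∀ x : M, TangentSpace I x} {x : M} (hX : CMDiffAt ∞ (T% X) x)
    (hY : CMDiffAt ∞ (T% Y) x) (hZ : CMDiffAt ∞ (T% Z) x) : CMDiffAt ∞ (koszul g X Y Z) x := by
  have h {X Y Z : ∀ x : M, TangentSpace I x} (hX : CMDiffAt ∞ (T% X) x)
      (hY : CMDiffAt ∞ (T% Y) x) (hZ : CMDiffAt ∞ (T% Z) x) :=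
    contMDiffAt_mvfderiv_apply (contMDiffAt_inner g hY hZ) hX
  have h' {X Y Z : ∀ x : M, TangentSpace I x} (hX : CMDiffAt ∞ (T% X) x)
      (hY : CMDiffAt ∞ (T% Y) x) (hZ : CMDiffAt ∞ (T% Z) x) :=
    contMDiffAt_inner g (contMDiffAt_mlieBracket hX hY) hZ
  exact (((((h hX hY hZ).add (h hY hZ hX)).sub (h hZ hX hY)).add (h' hX hY hZ)).sub
    (h' hX hZ hY)).sub (h' hY hZ hX)

lemma isSmoothConnection_leviCivita : IsSmoothConnection g (leviCivita g) := by
  intro x X Y Z hX hY hZ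
  refine (contMDiffAt_const (c := (1 / 2 : ℝ)).mul
    (contMDiffAt_koszul g hX hY hZ)).congr_of_eventuallyEq ?_
  filter_upwards [eventually_mdifferentiableAt hX, eventually_mdifferentiableAt hY,
    eventually_mdifferentiableAt hZ] with y hX hY hZ
  exact inner_leviCivita g hX hY hZ

variable {g} in
lemma IsSmoothConnection.contMDiffCovariantDerivative
    {cov : CovariantDerivative I E (fun x : M ↦ TangentSpace I x)}
    (h : IsSmoothConnection g cov) : cov.ContMDiffCovariantDerivative ∞ where
  contMDiff :=
    { contMDiff {Y} hY x _ := by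
        rw [contMDiffOn_univ] at hY
        refine (contMDiffAt_hom_of_inner g fun X Z hX hZ ↦ ?_).contMDiffWithinAt
        exact h x X Y Z hX (by simpa using hY x) hZ }

lemma isLeviCivita_leviCivita : IsLeviCivita g (leviCivita g) where
  smooth := (isSmoothConnection_leviCivita g).contMDiffCovariantDerivative
  metric := isMetricConnection_leviCivita g
  torsion_eq_zero := torsion_leviCivita g

end LeviCivita

/-! ### Metric connections, `∇φ`, and formulas for `N⁽¹⁾` and `dF` -/

lemma extDerivOne_swap {E : Type*} [NormedAddCommGroup E] [NormedSpace ℝ E]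
    {H : Type*} [TopologicalSpace H] {I : ModelWithCorners ℝ E H}
    {M : Type*} [TopologicalSpace M] [ChartedSpace H M]
    (α : ∀ x : M, TangentSpace I x →L[ℝ] ℝ) (X Y : ∀ x : M, TangentSpace I x)
    (x : M) : extDerivOne α Y X x = -extDerivOne α X Y x := by
  simp only [extDerivOne, mlieBracket_swap_apply (V := Y) (W := X), map_neg]
  ring

section MetricConnections

variable {E : Type*} [NormedAddCommGroup E] [NormedSpace ℝ E]
  {H : Type*} [TopologicalSpace H] {I : ModelWithCorners ℝ E H}
  {M : Type*} [TopologicalSpace M] [ChartedSpace H M] [IsManifold I ∞ M]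
  [FiniteDimensional ℝ E]
  {g : ContMDiffRiemannianMetric I ∞ E (fun x : M ↦ TangentSpace I x)}
  {cov D : CovariantDerivative I E (fun x : M ↦ TangentSpace I x)}

lemma mlieBracket_eq_sub_torsion {X Y : ∀ x : M, TangentSpace I x} {x : M}
    (hX : MDiffAt (T% X) x) (hY : MDiffAt (T% Y) x) :
    mlieBracket I X Y x = cov Y x (X x) - cov X x (Y x) - cov.torsion x (X x) (Y x) := by
  rw [cov.torsion_apply hX hY]
  abel

/-- A metric connection with totally skew-symmetric torsion is `∇^g + T / 2`: the difference
`g(∇_X Y - ∇^g_X Y, Z) - T(X, Y, Z) / 2` is symmetric in `X, Y` and skew-symmetric in `Y, Z`. -/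
lemma inner_eq_leviCivita_add_torsion (hD : IsMetricConnection g D) (hD' : D.torsion = 0)
    (hcov : IsMetricConnection g cov) (hT : HasSkewTorsion g cov)
    {X Y Z : ∀ x : M, TangentSpace I x} {x : M} (hX : MDiffAt (T% X) x)
    (hY : MDiffAt (T% Y) x) (hZ : MDiffAt (T% Z) x) :
    g.inner x (cov Y x (X x)) (Z x) =
      g.inner x (D Y x (X x)) (Z x) + (1 / 2) * g.inner x (cov.torsion x (X x) (Y x)) (Z x) := by
  have metric {X Y Z : ∀ x : M, TangentSpace I x} (_ : MDiffAt (T% X) x)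
      (hY : MDiffAt (T% Y) x) (hZ : MDiffAt (T% Z) x) :
      g.inner x (cov Y x (X x)) (Z x) - g.inner x (D Y x (X x)) (Z x) =
        -(g.inner x (cov Z x (X x)) (Y x) - g.inner x (D Z x (X x)) (Y x)) := by
    have h1 := hcov x Y Z (X x) hY hZ
    have h2 := hD x Y Z (X x) hY hZ
    rw [g.symm x (Y x)] at h1 h2
    linarith
  have torsion {X Y Z : ∀ x : M, TangentSpace I x} (hX : MDiffAt (T% X) x)
      (hY : MDiffAt (T% Y) x) (_ : MDiffAt (T% Z) x) :
      g.inner x (cov Y x (X x)) (Z x) - g.inner x (D Y x (X x)) (Z x) =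
        g.inner x (cov X x (Y x)) (Z x) - g.inner x (D X x (Y x)) (Z x) +
          g.inner x (cov.torsion x (X x) (Y x)) (Z x) := by
    have h1 := congr(g.inner x $(cov.torsion_apply hX hY) (Z x))
    have h2 := congr(g.inner x $(D.torsion_apply hX hY) (Z x))
    rw [hD'] at h2
    simp at h1 h2
    linarith
  have m1 := metric hX hY hZ
  have t1 := torsion hX hZ hY
  have m2 := metric hZ hX hY
  have t2 := torsion hZ hY hX
  have m3 := metric hY hZ hX
  have t3 := torsion hY hX hZ
  have s1 := (hT x (X x) (Y x) (Z x)).1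
  have s2 := (hT x (X x) (Y x) (Z x)).2
  have s3 := (hT x (Z x) (Y x) (X x)).2
  have s4 := (hT x (X x) (Z x) (Y x)).1
  linarith

/-- A metric connection with skew-symmetric torsion is determined by its torsion. -/
lemma sameConnection_of_torsion_eq {cov' : CovariantDerivative I E (fun x : M ↦ TangentSpace I x)}
    (hcov : IsMetricConnection g cov) (hT : HasSkewTorsion g cov)
    (hcov' : IsMetricConnection g cov') (hT' : HasSkewTorsion g cov')
    (h : ∀ (x : M) (X Y Z : ∀ x : M, TangentSpace I x), MDiffAt (T% X) x → MDiffAt (T% Y) x →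
      MDiffAt (T% Z) x → g.inner x (cov.torsion x (X x) (Y x)) (Z x) =
        g.inner x (cov'.torsion x (X x) (Y x)) (Z x)) : SameConnection cov cov' := by
  intro x Y hY
  refine endomorphism_ext g fun X Z hX hZ ↦ ?_
  rw [inner_eq_leviCivita_add_torsion (isMetricConnection_leviCivita g) (torsion_leviCivita g)
    hcov hT hX hY hZ, h x X Y Z hX hY hZ, ← inner_eq_leviCivita_add_torsion
    (isMetricConnection_leviCivita g) (torsion_leviCivita g) hcov' hT' hX hY hZ]

end MetricConnections

namespace MetricFStructure

variable {E : Type*} [NormedAddCommGroup E] [NormedSpace ℝ E]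
  {H : Type*} [TopologicalSpace H] {I : ModelWithCorners ℝ E H}
  {M : Type*} [TopologicalSpace M] [ChartedSpace H M] [IsManifold I ∞ M] {n s : ℕ}
  (S : MetricFStructure I M n s)

section Pointwise

lemma phi_xi (i : Fin s) (x : M) : S.phi x (S.xi i x) = 0 := by
  have h : S.xi i x ∈ (S.phi x).ker := by
    rw [S.ker_phi x]
    exact Submodule.subset_span ⟨i, rfl⟩
  exact h

lemma inner_xi_right (i : Fin s) (x : M) (v : TangentSpace I x) :
    S.g.inner x v (S.xi i x) = S.eta i x v := by
  have h := S.g_phi_phi x v (S.xi i x)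
  simp only [S.phi_xi, map_zero, S.eta_xi] at h
  simp at h
  linarith

lemma inner_xi_left (i : Fin s) (x : M) (v : TangentSpace I x) :
    S.g.inner x (S.xi i x) v = S.eta i x v := by
  rw [S.g.symm, S.inner_xi_right]

lemma inner_phi_left (x : M) (v w : TangentSpace I x) :
    S.g.inner x (S.phi x v) w = -S.g.inner x v (S.phi x w) := by
  have h := S.g_phi_phi x v (S.phi x w)
  simp only [S.phi_sq, S.eta_phi, map_add, map_neg, map_sum, map_smul, S.inner_xi_right] at h
  simp at h
  linarith

lemma inner_sum_xi {x : M} (c : Fin s → ℝ) (v : TangentSpace I x) :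
    S.g.inner x (∑ i, c i • S.xi i x) v = ∑ i, c i * S.eta i x v := by
  simp [S.inner_xi_left]

end Pointwise

section Fields

lemma mdifferentiableAt_xi (i : Fin s) (x : M) : MDiffAt (T% (S.xi i)) x :=
  (S.contMDiff_xi i x).mdifferentiableAt (by simp)

lemma mdifferentiableAt_phiField {X : ∀ x : M, TangentSpace I x} {x : M}
    (hX : MDiffAt (T% X) x) : MDiffAt (T% (S.phiField X)) x :=
  ((S.contMDiff_phi x).mdifferentiableAt (by simp)).clm_bundle_apply hX

lemma contMDiffAt_phiField {X : ∀ x : M, TangentSpace I x} {x : M}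
    (hX : CMDiffAt ∞ (T% X) x) : CMDiffAt ∞ (T% (S.phiField X)) x :=
  (S.contMDiff_phi x).clm_bundle_apply hX

lemma contMDiffAt_eta {X : ∀ x : M, TangentSpace I x} {x : M} (i : Fin s)
    (hX : CMDiffAt ∞ (T% X) x) : CMDiffAt ∞ (fun y ↦ S.eta i y (X y)) x := by
  simp only [← S.inner_xi_left]
  exact contMDiffAt_inner S.g (S.contMDiff_xi i x) hX

lemma phiField_xi (i : Fin s) : S.phiField (S.xi i) = 0 :=
  funext fun x ↦ S.phi_xi i x

end Fields

section Formulas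

variable [FiniteDimensional ℝ E]
  {cov : CovariantDerivative I E (fun x : M ↦ TangentSpace I x)}

/-- The 1-forms `η_i` are the metric duals of the `ξ_i`; so a metric connection with torsion `T`
satisfies `dη_i(X, Y) = g(∇_X ξ_i, Y) - g(∇_Y ξ_i, X) + η_i(T(X, Y))`. -/
lemma extDerivOne_eta (hcov : IsMetricConnection S.g cov) (i : Fin s)
    {X Y : ∀ x : M, TangentSpace I x} {x : M} (hX : MDiffAt (T% X) x) (hY : MDiffAt (T% Y) x) :
    extDerivOne (S.eta i) X Y x =
      S.g.inner x (cov (S.xi i) x (X x)) (Y x) - S.g.inner x (cov (S.xi i) x (Y x)) (X x)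
        + S.eta i x (cov.torsion x (X x) (Y x)) := by
  have h1 := hcov x (S.xi i) Y (X x) (S.mdifferentiableAt_xi i x) hY
  have h2 := hcov x (S.xi i) X (Y x) (S.mdifferentiableAt_xi i x) hX
  simp only [S.inner_xi_left] at h1 h2
  rw [extDerivOne, h1, h2, mlieBracket_eq_sub_torsion (cov := cov) hX hY]
  simp
  ring

/-- The covariant derivative `(∇_X φ) Y = ∇_X (φ Y) - φ (∇_X Y)`, as a bilinear map in `Y` and
`X` (in this order) at each point. -/
def phiDeriv (cov : CovariantDerivative I E (fun x : M ↦ TangentSpace I x)) (x : M) :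
    TangentSpace I x →L[ℝ] TangentSpace I x →L[ℝ] TangentSpace I x :=
  TensorialAt.mkHom (F := E) (I := I) (fun Y ↦ cov (S.phiField Y) x - S.phi x ∘L cov Y x) x
    { smul {f Y} hf hY := by
        have h : S.phiField (f • Y) = f • S.phiField Y :=
          funext fun y ↦ by simp [GloballyFramedFStructure.phiField]
        rw [h, cov.isCovariantDerivativeOnUniv.leibniz (S.mdifferentiableAt_phiField hY) hf,
          cov.isCovariantDerivativeOnUniv.leibniz hY hf]
        ext v
        simp [GloballyFramedFStructure.phiField, smul_sub]
      add {Y Y'} hY hY' := by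
        have h : S.phiField (Y + Y') = S.phiField Y + S.phiField Y' :=
          funext fun y ↦ by simp [GloballyFramedFStructure.phiField]
        rw [h, cov.isCovariantDerivativeOnUniv.add (S.mdifferentiableAt_phiField hY)
          (S.mdifferentiableAt_phiField hY'), cov.isCovariantDerivativeOnUniv.add hY hY']
        ext v
        simp
        abel }

lemma phiDeriv_apply {Y : ∀ x : M, TangentSpace I x} {x : M} (hY : MDiffAt (T% Y) x)
    (v : TangentSpace I x) :
    S.phiDeriv cov x (Y x) v = cov (S.phiField Y) x v - S.phi x (cov Y x v) := by
  rw [phiDeriv, TensorialAt.mkHom_apply _ hY]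
  rfl

/-- For any connection with torsion `T`, the Nijenhuis tensor is the sum of a part that is linear in
`∇φ`, a part that is linear in `T`, and `∑ dη_i ⊗ ξ_i`. -/
lemma nijenhuis_eq {X Y : ∀ x : M, TangentSpace I x} {x : M} (hX : MDiffAt (T% X) x)
    (hY : MDiffAt (T% Y) x) :
    S.nijenhuis X Y x =
      S.phiDeriv cov x (Y x) (S.phi x (X x)) - S.phiDeriv cov x (X x) (S.phi x (Y x))
        + S.phi x (S.phiDeriv cov x (X x) (Y x)) - S.phi x (S.phiDeriv cov x (Y x) (X x))
        - cov.torsion x (S.phi x (X x)) (S.phi x (Y x))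
        - S.phi x (S.phi x (cov.torsion x (X x) (Y x)))
        + S.phi x (cov.torsion x (X x) (S.phi x (Y x)))
        + S.phi x (cov.torsion x (S.phi x (X x)) (Y x))
        + ∑ i, extDerivOne (S.eta i) X Y x • S.xi i x := by
  have hX' := S.mdifferentiableAt_phiField hX
  have hY' := S.mdifferentiableAt_phiField hY
  rw [GloballyFramedFStructure.nijenhuis, mlieBracket_eq_sub_torsion (cov := cov) hX hY,
    mlieBracket_eq_sub_torsion (cov := cov) hX' hY', mlieBracket_eq_sub_torsion (cov := cov) hX hY',
    mlieBracket_eq_sub_torsion (cov := cov) hX' hY]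
  simp only [S.phiDeriv_apply hX, S.phiDeriv_apply hY, map_sub]
  simp only [GloballyFramedFStructure.phiField]
  abel

/-- For a metric connection with torsion `T`, `dF` is the cyclic sum of
`g(Y, (∇_X φ) Z) + g(T(X, Y), φZ)`. -/
lemma extDerivTwo_fundForm (hcov : IsMetricConnection S.g cov)
    {X Y Z : ∀ x : M, TangentSpace I x} {x : M} (hX : MDiffAt (T% X) x) (hY : MDiffAt (T% Y) x)
    (hZ : MDiffAt (T% Z) x) :
    extDerivTwo S.fundForm X Y Z x =
      S.g.inner x (Y x) (S.phiDeriv cov x (Z x) (X x))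
        + S.g.inner x (Z x) (S.phiDeriv cov x (X x) (Y x))
        + S.g.inner x (X x) (S.phiDeriv cov x (Y x) (Z x))
        + S.g.inner x (cov.torsion x (X x) (Y x)) (S.phi x (Z x))
        + S.g.inner x (cov.torsion x (Y x) (Z x)) (S.phi x (X x))
        + S.g.inner x (cov.torsion x (Z x) (X x)) (S.phi x (Y x)) := by
  have h1 := hcov x Y (S.phiField Z) (X x) hY (S.mdifferentiableAt_phiField hZ)
  have h2 := hcov x Z (S.phiField X) (Y x) hZ (S.mdifferentiableAt_phiField hX)
  have h3 := hcov x X (S.phiField Y) (Z x) hX (S.mdifferentiableAt_phiField hY)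
  simp only [GloballyFramedFStructure.phiField] at h1 h2 h3
  simp only [extDerivTwo, fundForm]
  rw [h1, h2, h3, mlieBracket_eq_sub_torsion (cov := cov) hX hY,
    mlieBracket_eq_sub_torsion (cov := cov) hZ hX, mlieBracket_eq_sub_torsion (cov := cov) hY hZ]
  simp only [S.phiDeriv_apply hX, S.phiDeriv_apply hY, S.phiDeriv_apply hZ, map_sub, sub_apply]
  have e1 := S.inner_phi_left x (X x) (cov Y x (Z x))
  have e2 := S.inner_phi_left x (Y x) (cov Z x (X x))
  have e3 := S.inner_phi_left x (Z x) (cov X x (Y x))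
  have c1 := S.g.symm x (S.phi x (X x)) (cov Y x (Z x))
  have c2 := S.g.symm x (S.phi x (Y x)) (cov Z x (X x))
  have c3 := S.g.symm x (S.phi x (Z x)) (cov X x (Y x))
  linarith

/-- For a metric connection, `∇_X φ` is skew-symmetric, as `φ` is. -/
lemma inner_phiDeriv_swap (hcov : IsMetricConnection S.g cov) {x : M} (u v w : TangentSpace I x) :
    S.g.inner x (S.phiDeriv cov x v u) w = -S.g.inner x (S.phiDeriv cov x w u) v := by
  have hY := mdifferentiableAt_extend I E v
  have hZ := mdifferentiableAt_extend I E w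
  have h1 := hcov x (S.phiField (extend E v)) (extend E w) u (S.mdifferentiableAt_phiField hY) hZ
  have h2 := hcov x (S.phiField (extend E w)) (extend E v) u (S.mdifferentiableAt_phiField hZ) hY
  have h3 := S.phiDeriv_apply (cov := cov) hY u
  have h4 := S.phiDeriv_apply (cov := cov) hZ u
  have h5 : (fun y ↦ S.g.inner y (S.phiField (extend E v) y) (extend E w y)) =
      -fun y ↦ S.g.inner y (S.phiField (extend E w) y) (extend E v y) := by
    ext y
    simp only [GloballyFramedFStructure.phiField, Pi.neg_apply]
    rw [S.inner_phi_left, S.g.symm]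
  rw [h5, mvfderiv_neg, neg_apply, h2] at h1
  simp only [extend_apply_self, GloballyFramedFStructure.phiField] at h1 h3 h4
  rw [h3, h4]
  have h6 := S.inner_phi_left x v (cov (extend E w) x u)
  have h7 := S.inner_phi_left x (cov (extend E v) x u) w
  have h8 := S.inner_phi_left x w (cov (extend E v) x u)
  have h9 := S.inner_phi_left x (cov (extend E w) x u) v
  have h10 := S.g.symm x (S.phi x w) (cov (extend E v) x u)
  have h11 := S.g.symm x (S.phi x v) (cov (extend E w) x u)
  simp only [map_sub, sub_apply]
  linarith

end Formulas

end MetricFStructure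

/-! ### Uniqueness, the torsion, and Killing vector fields -/

namespace MetricFStructure

variable {E : Type*} [NormedAddCommGroup E] [NormedSpace ℝ E]
  {H : Type*} [TopologicalSpace H] {I : ModelWithCorners ℝ E H}
  {M : Type*} [TopologicalSpace M] [ChartedSpace H M] [IsManifold I ∞ M] {n s : ℕ}
  {S : MetricFStructure I M n s}

section Normal

lemma eta_sum_xi (i : Fin s) {x : M} (c : Fin s → ℝ) :
    S.eta i x (∑ j, c j • S.xi j x) = c i := by
  simp [S.eta_xi]

lemma mvfderiv_eta_phiField (i : Fin s) (X : ∀ x : M, TangentSpace I x) (x : M) :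
    mvfderiv I (fun y ↦ S.eta i y (S.phiField X y)) x = 0 := by
  simp only [GloballyFramedFStructure.phiField, S.eta_phi]
  exact mvfderiv_const 0

lemma mvfderiv_eta_xi (i j : Fin s) (x : M) :
    mvfderiv I (fun y ↦ S.eta i y (S.xi j y)) x = 0 := by
  simp only [S.eta_xi]
  exact mvfderiv_const _

/-- The `η_i`-component of `N⁽¹⁾(X, Y) = 0`. -/
lemma extDerivOne_phiField_phiField (hN : S.IsNormal) (i : Fin s)
    {X Y : ∀ x : M, TangentSpace I x} {x : M} (hX : MDiffAt (T% X) x) (hY : MDiffAt (T% Y) x) :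
    extDerivOne (S.eta i) (S.phiField X) (S.phiField Y) x = extDerivOne (S.eta i) X Y x := by
  have h := congr(S.eta i x $(hN x X Y hX hY))
  rw [GloballyFramedFStructure.nijenhuis] at h
  simp only [map_add, map_sub, S.eta_phi, eta_sum_xi, map_zero] at h
  rw [extDerivOne, mvfderiv_eta_phiField, mvfderiv_eta_phiField]
  simp only [zero_apply]
  linarith

/-- The `η_i`-component of `N⁽¹⁾(X, ξ_j) = 0`. -/
lemma extDerivOne_xi_right (hN : S.IsNormal) (i j : Fin s) {X : ∀ x : M, TangentSpace I x} {x : M}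
    (hX : MDiffAt (T% X) x) : extDerivOne (S.eta i) X (S.xi j) x = 0 := by
  have h := congr(S.eta i x $(hN x X (S.xi j) hX (S.mdifferentiableAt_xi j x)))
  rw [GloballyFramedFStructure.nijenhuis, S.phiField_xi] at h
  simpa only [map_add, map_sub, S.eta_phi, eta_sum_xi, map_zero, mlieBracket_zero_right,
    Pi.zero_apply, zero_add, sub_zero, add_zero] using h

lemma extDerivOne_xi_left (hN : S.IsNormal) (i j : Fin s) {X : ∀ x : M, TangentSpace I x} {x : M}
    (hX : MDiffAt (T% X) x) : extDerivOne (S.eta i) (S.xi j) X x = 0 := by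
  rw [extDerivOne_swap, extDerivOne_xi_right hN i j hX, neg_zero]

lemma eq_zero_of_phi_eq_zero {x : M} {v : TangentSpace I x} (h : S.phi x v = 0)
    (h' : ∀ i, S.eta i x v = 0) : v = 0 := by
  have := S.phi_sq x v
  simpa [h, h'] using this

lemma eta_mlieBracket_xi_left (hN : S.IsNormal) (i j : Fin s) {X : ∀ x : M, TangentSpace I x}
    {x : M} (hX : MDiffAt (T% X) x) :
    S.eta i x (mlieBracket I (S.xi j) X x) =
      mvfderiv I (fun y ↦ S.eta i y (X y)) x (S.xi j x) := by
  have h := extDerivOne_xi_left hN i j hX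
  rw [extDerivOne, mvfderiv_eta_xi, zero_apply] at h
  linarith

/-- On a normal manifold `L_{ξ_j} φ = 0`. -/
lemma mlieBracket_xi_phiField (hN : S.IsNormal) (j : Fin s) {X : ∀ x : M, TangentSpace I x}
    {x : M} (hX : MDiffAt (T% X) x) :
    mlieBracket I (S.xi j) (S.phiField X) x = S.phi x (mlieBracket I (S.xi j) X x) := by
  have h := hN x (S.xi j) X (S.mdifferentiableAt_xi j x) hX
  rw [GloballyFramedFStructure.nijenhuis, S.phiField_xi] at h
  simp only [mlieBracket_zero_left, Pi.zero_apply, map_zero, extDerivOne_xi_left hN _ j hX,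
    zero_smul, Finset.sum_const_zero, zero_add, sub_zero, add_zero] at h
  refine sub_eq_zero.1 (S.eq_zero_of_phi_eq_zero ?_ fun i ↦ ?_)
  · rw [map_sub, ← neg_sub, h, neg_zero]
  · rw [map_sub, S.eta_phi, eta_mlieBracket_xi_left hN i j (S.mdifferentiableAt_phiField hX),
      mvfderiv_eta_phiField, zero_apply, sub_zero]

lemma mlieBracket_xi_xi (hN : S.IsNormal) (i j : Fin s) (x : M) :
    mlieBracket I (S.xi i) (S.xi j) x = 0 := by
  refine S.eq_zero_of_phi_eq_zero ?_ fun k ↦ ?_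
  · rw [← mlieBracket_xi_phiField hN i (S.mdifferentiableAt_xi j x), S.phiField_xi,
      mlieBracket_zero_right, Pi.zero_apply]
  · rw [eta_mlieBracket_xi_left hN k i (S.mdifferentiableAt_xi j x), mvfderiv_eta_xi, zero_apply]

lemma inner_phi_phi_right (x : M) (u v : TangentSpace I x) :
    S.g.inner x u (S.phi x (S.phi x v)) =
      -S.g.inner x u v + ∑ i, S.eta i x v * S.eta i x u := by
  rw [S.phi_sq]
  simp [S.inner_xi_right]

lemma inner_phi_phi_left (x : M) (u v : TangentSpace I x) :
    S.g.inner x (S.phi x (S.phi x u)) v =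
      -S.g.inner x u v + ∑ i, S.eta i x u * S.eta i x v := by
  rw [S.g.symm, inner_phi_phi_right, S.g.symm]

lemma IsKStructure.dPhiFundForm_eq_zero (h : S.IsKStructure) {X Y Z : ∀ x : M, TangentSpace I x}
    {x : M} (hX : MDiffAt (T% X) x) (hY : MDiffAt (T% Y) x) (hZ : MDiffAt (T% Z) x) :
    S.dPhiFundForm X Y Z x = 0 := by
  rw [dPhiFundForm, h.closed x _ _ _ (S.mdifferentiableAt_phiField hX)
    (S.mdifferentiableAt_phiField hY) (S.mdifferentiableAt_phiField hZ), neg_zero]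

end Normal

section Torsion

variable [FiniteDimensional ℝ E]
  {cov : CovariantDerivative I E (fun x : M ↦ TangentSpace I x)}

lemma IsAlmostMetricPhiConnection.phiDeriv_eq_zero (h : S.IsAlmostMetricPhiConnection cov)
    {X : ∀ x : M, TangentSpace I x} {x : M} (hX : MDiffAt (T% X) x) (v : TangentSpace I x) :
    S.phiDeriv cov x (X x) v = 0 := by
  rw [S.phiDeriv_apply hX, h.parallel_phi x X v hX, sub_self]

lemma IsAlmostMetricPhiConnection.eta_torsion (h : S.IsAlmostMetricPhiConnection cov)
    (i : Fin s) {X Y : ∀ x : M, TangentSpace I x} {x : M} (hX : MDiffAt (T% X) x)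
    (hY : MDiffAt (T% Y) x) :
    S.eta i x (cov.torsion x (X x) (Y x)) = extDerivOne (S.eta i) X Y x := by
  rw [S.extDerivOne_eta h.metric i hX hY, h.parallel_xi, h.parallel_xi]
  simp

/-- On a normal manifold the torsion of an almost metric `φ`-connection satisfies
`T(X, Y, Z) = T(φX, φY, Z) + T(X, φY, φZ) + T(φX, Y, φZ)`: as `∇φ = 0`, this is what `N⁽¹⁾ = 0`
says. -/
lemma IsAlmostMetricPhiConnection.inner_torsion (hN : S.IsNormal)
    (h : S.IsAlmostMetricPhiConnection cov) {X Y : ∀ x : M, TangentSpace I x} {x : M}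
    (hX : MDiffAt (T% X) x) (hY : MDiffAt (T% Y) x) (w : TangentSpace I x) :
    S.g.inner x (cov.torsion x (X x) (Y x)) w =
      S.g.inner x (cov.torsion x (S.phi x (X x)) (S.phi x (Y x))) w
        + S.g.inner x (cov.torsion x (X x) (S.phi x (Y x))) (S.phi x w)
        + S.g.inner x (cov.torsion x (S.phi x (X x)) (Y x)) (S.phi x w) := by
  have hnij := congr(S.g.inner x $(hN x X Y hX hY) w)
  rw [S.nijenhuis_eq (cov := cov) hX hY] at hnij
  simp only [h.phiDeriv_eq_zero hX, h.phiDeriv_eq_zero hY, map_zero, map_add, map_sub, add_apply,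
    sub_apply, zero_apply, inner_phi_phi_left, S.inner_sum_xi, h.eta_torsion _ hX hY] at hnij
  simp only [S.inner_phi_left] at hnij
  linarith

lemma IsAlmostMetricPhiConnection.eta_torsion_phi_phi (hN : S.IsNormal)
    (h : S.IsAlmostMetricPhiConnection cov) (i : Fin s) {X Y : ∀ x : M, TangentSpace I x} {x : M}
    (hX : MDiffAt (T% X) x) (hY : MDiffAt (T% Y) x) :
    S.eta i x (cov.torsion x (S.phi x (X x)) (S.phi x (Y x))) = extDerivOne (S.eta i) X Y x := by
  have h1 := h.eta_torsion i (S.mdifferentiableAt_phiField hX) (S.mdifferentiableAt_phiField hY)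
  rw [extDerivOne_phiField_phiField hN i hX hY] at h1
  exact h1

/-- As `∇φ = 0`, the form `d^φ F` is the cyclic sum of `-T(φX, φY, φ²Z)`. -/
lemma IsAlmostMetricPhiConnection.dPhiFundForm_eq (hN : S.IsNormal)
    (h : S.IsAlmostMetricPhiConnection cov) {X Y Z : ∀ x : M, TangentSpace I x} {x : M}
    (hX : MDiffAt (T% X) x) (hY : MDiffAt (T% Y) x) (hZ : MDiffAt (T% Z) x) :
    S.dPhiFundForm X Y Z x =
      S.g.inner x (cov.torsion x (S.phi x (X x)) (S.phi x (Y x))) (Z x)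
        + S.g.inner x (cov.torsion x (S.phi x (Y x)) (S.phi x (Z x))) (X x)
        + S.g.inner x (cov.torsion x (S.phi x (Z x)) (S.phi x (X x))) (Y x)
        - ∑ i, wedgeExtDeriv (S.eta i) X Y Z x := by
  have hX' := S.mdifferentiableAt_phiField hX
  have hY' := S.mdifferentiableAt_phiField hY
  have hZ' := S.mdifferentiableAt_phiField hZ
  rw [dPhiFundForm, S.extDerivTwo_fundForm h.metric hX' hY' hZ']
  simp only [h.phiDeriv_eq_zero hX', h.phiDeriv_eq_zero hY', h.phiDeriv_eq_zero hZ', map_zero]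
  simp only [GloballyFramedFStructure.phiField, inner_phi_phi_right]
  simp only [h.eta_torsion_phi_phi hN _ hX hY, h.eta_torsion_phi_phi hN _ hY hZ,
    h.eta_torsion_phi_phi hN _ hZ hX, extDerivOne_swap _ X Z, mul_neg, Finset.sum_neg_distrib,
    wedgeExtDeriv, Finset.sum_add_distrib, Finset.sum_sub_distrib]
  ring

/-- The torsion of an almost metric `φ`-connection with skew-torsion on a normal manifold. -/
theorem IsSkewPhiConnection.inner_torsion (hN : S.IsNormal) (h : S.IsSkewPhiConnection cov)
    {X Y Z : ∀ x : M, TangentSpace I x} {x : M} (hX : MDiffAt (T% X) x) (hY : MDiffAt (T% Y) x)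
    (hZ : MDiffAt (T% Z) x) :
    S.g.inner x (cov.torsion x (X x) (Y x)) (Z x) =
      (∑ i, wedgeExtDeriv (S.eta i) X Y Z x) + S.dPhiFundForm X Y Z x := by
  rw [h.1.inner_torsion hN hX hY, h.1.dPhiFundForm_eq hN hX hY hZ]
  have t1 := (h.2 x (S.phi x (Y x)) (S.phi x (Z x)) (X x)).2
  have t2 := (h.2 x (S.phi x (Y x)) (X x) (S.phi x (Z x))).1
  have t3 := (h.2 x (S.phi x (Z x)) (S.phi x (X x)) (Y x)).1
  have t4 := (h.2 x (S.phi x (X x)) (S.phi x (Z x)) (Y x)).2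
  linarith

/-- If an almost metric `φ`-connection with skew-torsion exists, then `L_{ξ_i} g = 0`: since
`∇g = 0` and `∇ξ_i = 0`, one has `(L_{ξ_i} g)(Y, Z) = T(ξ_i, Y, Z) + T(ξ_i, Z, Y)`. -/
lemma IsSkewPhiConnection.isKilling (h : S.IsSkewPhiConnection cov) (i : Fin s) :
    IsKilling S.g (S.xi i) := by
  obtain ⟨h, hT⟩ := h
  intro x Y Z hY hZ
  rw [h.metric x Y Z _ hY hZ, mlieBracket_eq_sub_torsion (cov := cov) (S.mdifferentiableAt_xi i x)
    hY, mlieBracket_eq_sub_torsion (cov := cov) (S.mdifferentiableAt_xi i x) hZ, h.parallel_xi,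
    h.parallel_xi]
  have t := (hT x (S.xi i x) (Y x) (Z x)).2
  have c := S.g.symm x (Y x) (cov.torsion x (S.xi i x) (Z x))
  simp only [map_sub, sub_apply, sub_zero]
  linarith

/-- Two almost metric `φ`-connections with skew-torsion on a normal manifold coincide. -/
lemma IsSkewPhiConnection.sameConnection (hN : S.IsNormal) (h : S.IsSkewPhiConnection cov)
    {cov' : CovariantDerivative I E (fun x : M ↦ TangentSpace I x)}
    (h' : S.IsSkewPhiConnection cov') : SameConnection cov' cov :=
  sameConnection_of_torsion_eq h'.1.metric h'.2 h.1.metric h.2 fun x X Y Z hX hY hZ ↦ by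
    rw [h'.inner_torsion hN hX hY hZ, h.inner_torsion hN hX hY hZ]

end Torsion

section Killing

variable [FiniteDimensional ℝ E]

/-- `ξ` is a Killing vector field if and only if `∇^g ξ` is skew-symmetric. -/
lemma _root_.MetricF.isKilling_iff
    {g : ContMDiffRiemannianMetric I ∞ E (fun x : M ↦ TangentSpace I x)}
    {ξ : ∀ x : M, TangentSpace I x} (hξ : ∀ x, MDiffAt (T% ξ) x) :
    IsKilling g ξ ↔ ∀ (x : M) (u v : TangentSpace I x),
      g.inner x (leviCivita g ξ x u) v = -g.inner x (leviCivita g ξ x v) u := by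
  have key (x : M) {Y Z : ∀ x : M, TangentSpace I x} (hY : MDiffAt (T% Y) x)
      (hZ : MDiffAt (T% Z) x) :
      g.inner x (mlieBracket I ξ Y x) (Z x) + g.inner x (Y x) (mlieBracket I ξ Z x) =
        mvfderiv I (fun y ↦ g.inner y (Y y) (Z y)) x (ξ x)
        - (g.inner x (leviCivita g ξ x (Y x)) (Z x)
          + g.inner x (leviCivita g ξ x (Z x)) (Y x)) := by
    rw [isMetricConnection_leviCivita g x Y Z _ hY hZ,
      mlieBracket_eq_sub_torsion (cov := leviCivita g) (hξ x) hY,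
      mlieBracket_eq_sub_torsion (cov := leviCivita g) (hξ x) hZ, torsion_leviCivita,
      g.symm x (leviCivita g ξ x (Z x))]
    simp
    ring
  refine ⟨fun h x u v ↦ ?_, fun h x Y Z hY hZ ↦ ?_⟩
  · have hY := mdifferentiableAt_extend I E u
    have hZ := mdifferentiableAt_extend I E v
    have h1 := h x _ _ hY hZ
    rw [key x hY hZ] at h1
    simp only [extend_apply_self] at h1
    linarith
  · rw [key x hY hZ, h x (Y x) (Z x)]
    ring

/-- The vector fields `ξ_i` of a `K`-manifold are Killing. The form `L_{ξ_i} g` vanishes on pairs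
`(Y, φZ)`, because `L_{ξ_i} F = 0` (by `dF = 0` and `F(ξ_i, ·) = 0`) and `L_{ξ_i} φ = 0`; it
vanishes on pairs `(Y, ξ_k)`, because `dη_k(ξ_i, ·) = 0` and `[ξ_i, ξ_k] = 0`. -/
lemma IsKStructure.isKilling (h : S.IsKStructure) (i : Fin s) : IsKilling S.g (S.xi i) := by
  have hN := h.normal
  have key (x : M) {Y Z : ∀ x : M, TangentSpace I x} (hY : MDiffAt (T% Y) x)
      (hZ : MDiffAt (T% Z) x) :
      S.g.inner x (leviCivita S.g (S.xi i) x (Y x)) (Z x)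
          + S.g.inner x (leviCivita S.g (S.xi i) x (Z x)) (Y x) =
        mvfderiv I (fun y ↦ S.g.inner y (Y y) (Z y)) x (S.xi i x)
          - S.g.inner x (mlieBracket I (S.xi i) Y x) (Z x)
          - S.g.inner x (Y x) (mlieBracket I (S.xi i) Z x) := by
    rw [isMetricConnection_leviCivita S.g x Y Z _ hY hZ,
      mlieBracket_eq_sub_torsion (cov := leviCivita S.g) (S.mdifferentiableAt_xi i x) hY,
      mlieBracket_eq_sub_torsion (cov := leviCivita S.g) (S.mdifferentiableAt_xi i x) hZ,
      torsion_leviCivita, S.g.symm x (leviCivita S.g (S.xi i) x (Z x))]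
    simp
  rw [isKilling_iff (S.mdifferentiableAt_xi i)]
  have hphi (x : M) (u v : TangentSpace I x) :
      S.g.inner x (leviCivita S.g (S.xi i) x u) (S.phi x v)
        + S.g.inner x (leviCivita S.g (S.xi i) x (S.phi x v)) u = 0 := by
    have hY := mdifferentiableAt_extend I E u
    have hZ := mdifferentiableAt_extend I E v
    have h1 := key x hY (S.mdifferentiableAt_phiField hZ)
    have h2 := h.closed x (S.xi i) (extend E u) (extend E v) (S.mdifferentiableAt_xi i x) hY hZ
    have h3 : (fun y ↦ S.fundForm y (extend E v y) (S.xi i y)) = fun _ ↦ 0 :=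
      funext fun y ↦ by rw [fundForm, S.phi_xi, map_zero]
    have h4 : (fun y ↦ S.fundForm y (S.xi i y) (extend E u y)) = fun _ ↦ 0 :=
      funext fun y ↦ by rw [fundForm, S.inner_xi_left, S.eta_phi]
    rw [extDerivTwo, h3, h4, mvfderiv_const,
      mlieBracket_swap_apply (V := extend E v)] at h2
    simp only [fundForm, S.phi_xi, map_zero, zero_apply, extend_apply_self, map_neg, neg_apply,
      add_zero, sub_zero] at h2
    rw [mlieBracket_xi_phiField hN i hZ] at h1
    simp only [extend_apply_self, GloballyFramedFStructure.phiField] at h1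
    have h5 := S.inner_phi_left x (mlieBracket I (S.xi i) (extend E v) x) u
    have h6 := S.g.symm x (S.phi x (mlieBracket I (S.xi i) (extend E v) x)) u
    linarith
  have hxi (x : M) (u : TangentSpace I x) (k : Fin s) :
      S.g.inner x (leviCivita S.g (S.xi i) x u) (S.xi k x)
        + S.g.inner x (leviCivita S.g (S.xi i) x (S.xi k x)) u = 0 := by
    have hY := mdifferentiableAt_extend I E u
    have h1 := key x hY (S.mdifferentiableAt_xi k x)
    simp only [extend_apply_self, S.inner_xi_right, mlieBracket_xi_xi hN, map_zero,
      eta_mlieBracket_xi_left hN k i hY, sub_self] at h1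
    simpa only [S.inner_xi_right] using h1
  intro x u v
  -- The identity is linear in `v = -φ(φ v) + ∑ η_k(v) ξ_k`.
  have hv : v = -S.phi x (S.phi x v) + ∑ k, S.eta k x v • S.xi k x := by
    rw [S.phi_sq]; abel
  rw [← add_eq_zero_iff_eq_neg, hv]
  have h1 := hphi x u (S.phi x v)
  have h2 : ∑ k, S.eta k x v * (S.g.inner x (leviCivita S.g (S.xi i) x u) (S.xi k x)
        + S.g.inner x (leviCivita S.g (S.xi i) x (S.xi k x)) u) = 0 :=
    Finset.sum_eq_zero fun k _ ↦ by rw [hxi, mul_zero]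
  simp only [mul_add, Finset.sum_add_distrib] at h2
  simp only [map_add, map_neg, map_sum, map_smul, add_apply, neg_apply, sum_apply, smul_apply,
    smul_eq_mul]
  linarith

end Killing

end MetricFStructure

/-! ### The connection `∇^g + (1/2) ∑ η_i ∧ dη_i` -/

section AddOneForm

variable {E : Type*} [NormedAddCommGroup E] [NormedSpace ℝ E]
  {H : Type*} [TopologicalSpace H] {I : ModelWithCorners ℝ E H}
  {M : Type*} [TopologicalSpace M] [ChartedSpace H M] [IsManifold I ∞ M]
  {g : ContMDiffRiemannianMetric I ∞ E (fun x : M ↦ TangentSpace I x)}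
  {cov : CovariantDerivative I E (fun x : M ↦ TangentSpace I x)}
  {A : ∀ x : M, TangentSpace I x →L[ℝ] TangentSpace I x →L[ℝ] TangentSpace I x}

lemma addOneForm_apply (Y : ∀ x : M, TangentSpace I x) (x : M) (v : TangentSpace I x) :
    cov.addOneForm A Y x v = cov Y x v + A x (Y x) v :=
  rfl

lemma torsion_addOneForm [FiniteDimensional ℝ E] (x : M) (u v : TangentSpace I x) :
    (cov.addOneForm A).torsion x u v = cov.torsion x u v + A x v u - A x u v := by
  simp only [CovariantDerivative.torsion_apply_eq_extend, addOneForm_apply, extend_apply_self]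
  abel

lemma IsMetricConnection.addOneForm (h : IsMetricConnection g cov)
    (hA : ∀ (x : M) (u v w : TangentSpace I x),
      g.inner x (A x v u) w = -g.inner x (A x w u) v) :
    IsMetricConnection g (cov.addOneForm A) := by
  intro x Y Z v hY hZ
  rw [h x Y Z v hY hZ, addOneForm_apply, addOneForm_apply, map_add, map_add, add_apply,
    hA x v (Y x), g.symm x (Y x) (A x (Z x) v)]
  ring

lemma IsSmoothConnection.addOneForm (h : IsSmoothConnection g cov)
    (hA : ∀ (x : M) (X Y Z : ∀ x : M, TangentSpace I x),
      CMDiffAt ∞ (T% X) x → CMDiffAt ∞ (T% Y) x → CMDiffAt ∞ (T% Z) x →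
        CMDiffAt ∞ (fun y ↦ g.inner y (A y (Y y) (X y)) (Z y)) x) :
    IsSmoothConnection g (cov.addOneForm A) := by
  intro x X Y Z hX hY hZ
  simp only [addOneForm_apply, map_add, add_apply]
  exact (h x X Y Z hX hY hZ).add (hA x X Y Z hX hY hZ)

end AddOneForm

namespace MetricFStructure

variable {E : Type*} [NormedAddCommGroup E] [NormedSpace ℝ E] [FiniteDimensional ℝ E]
  {H : Type*} [TopologicalSpace H] {I : ModelWithCorners ℝ E H}
  {M : Type*} [TopologicalSpace M] [ChartedSpace H M] [IsManifold I ∞ M] {n s : ℕ}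

section FrameConnection

variable (S : MetricFStructure I M n s)

/-- The bilinear form `a_i(u, v) = g(∇^g_u ξ_i, v)`. If `ξ_i` is Killing, then `dη_i = 2 a_i`. -/
def nablaXi (i : Fin s) (x : M) (u v : TangentSpace I x) : ℝ :=
  S.g.inner x (leviCivita S.g (S.xi i) x u) v

/-- The correction term `(v, u) ↦ ∑ η_i(u) ∇^g_v ξ_i - η_i(v) ∇^g_u ξ_i + a_i(u, v) ξ_i` of
`frameConnection`, with the differentiated vector `v` as first argument. -/
def frameCorrection (x : M) :
    TangentSpace I x →L[ℝ] TangentSpace I x →L[ℝ] TangentSpace I x :=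
  (LinearMap.mk₂ ℝ (fun v u : TangentSpace I x ↦
    ∑ i, (S.eta i x u • leviCivita S.g (S.xi i) x v - S.eta i x v • leviCivita S.g (S.xi i) x u
      + S.nablaXi i x u v • S.xi i x))
    (fun v v' u ↦ by
      rw [← Finset.sum_add_distrib]
      refine Finset.sum_congr rfl fun i _ ↦ ?_
      simp only [nablaXi, map_add]
      module)
    (fun c v u ↦ by
      rw [Finset.smul_sum]
      refine Finset.sum_congr rfl fun i _ ↦ ?_
      simp only [nablaXi, map_smul, smul_eq_mul]
      module)
    (fun v u u' ↦ by
      rw [← Finset.sum_add_distrib]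
      refine Finset.sum_congr rfl fun i _ ↦ ?_
      simp only [nablaXi, map_add, add_apply]
      module)
    (fun c v u ↦ by
      rw [Finset.smul_sum]
      refine Finset.sum_congr rfl fun i _ ↦ ?_
      simp only [nablaXi, map_smul, smul_apply, smul_eq_mul]
      module)).toContinuousBilinearMap

lemma frameCorrection_apply (x : M) (v u : TangentSpace I x) :
    S.frameCorrection x v u =
      ∑ i, (S.eta i x u • leviCivita S.g (S.xi i) x v
        - S.eta i x v • leviCivita S.g (S.xi i) x u + S.nablaXi i x u v • S.xi i x) :=
  rfl

lemma inner_frameCorrection (x : M) (u v w : TangentSpace I x) :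
    S.g.inner x (S.frameCorrection x v u) w =
      ∑ i, (S.eta i x u * S.nablaXi i x v w - S.eta i x v * S.nablaXi i x u w
        + S.nablaXi i x u v * S.eta i x w) := by
  simp [frameCorrection_apply, nablaXi, S.inner_xi_left]

/-- The connection `∇^g + (1/2) ∑ η_i ∧ dη_i`, written with `dη_i = 2 a_i`: if the `ξ_i` are Killing
and the structure is normal, then it is metric and has parallel `ξ_i`. -/
def frameConnection : CovariantDerivative I E (fun x : M ↦ TangentSpace I x) :=
  (leviCivita S.g).addOneForm S.frameCorrection

lemma isSmoothConnection_frameConnection : IsSmoothConnection S.g S.frameConnection := by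
  refine (isSmoothConnection_leviCivita S.g).addOneForm fun x X Y Z hX hY hZ ↦ ?_
  simp only [inner_frameCorrection]
  have ha {X Y : ∀ x : M, TangentSpace I x} (hX : CMDiffAt ∞ (T% X) x)
      (hY : CMDiffAt ∞ (T% Y) x) (i : Fin s) :
      CMDiffAt ∞ (fun y ↦ S.nablaXi i y (X y) (Y y)) x :=
    isSmoothConnection_leviCivita S.g x X (S.xi i) Y hX (S.contMDiff_xi i x) hY
  exact ContMDiffAt.sum fun i _ ↦
    (((S.contMDiffAt_eta i hX).mul (ha hY hZ i)).sub ((S.contMDiffAt_eta i hY).mul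
      (ha hX hZ i))).add ((ha hX hY i).mul (S.contMDiffAt_eta i hZ))

/-- The covariant derivative of `φ` with respect to `frameConnection`, as the bilinear map
`(v, u) ↦ (∇_u φ) v`. -/
def nablaPhi (x : M) : TangentSpace I x →L[ℝ] TangentSpace I x →L[ℝ] TangentSpace I x :=
  S.phiDeriv S.frameConnection x

end FrameConnection

variable {S : MetricFStructure I M n s}

lemma nablaPhi_apply {Y : ∀ x : M, TangentSpace I x} {x : M} (hY : MDiffAt (T% Y) x)
    (v : TangentSpace I x) :
    S.nablaPhi x (Y x) v = S.frameConnection (S.phiField Y) x v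
      - S.phi x (S.frameConnection Y x v) :=
  S.phiDeriv_apply hY v

section KillingNormal

/-- The hypothesis that the `ξ_i` are Killing, in the form in which it is used. -/
lemma nablaXi_swap (hK : ∀ i, IsKilling S.g (S.xi i)) (i : Fin s) (x : M)
    (u v : TangentSpace I x) : S.nablaXi i x u v = -S.nablaXi i x v u :=
  (isKilling_iff (S.mdifferentiableAt_xi i)).1 (hK i) x u v

lemma extDerivOne_eta_eq_nablaXi (hK : ∀ i, IsKilling S.g (S.xi i)) (i : Fin s)
    {X Y : ∀ x : M, TangentSpace I x} {x : M} (hX : MDiffAt (T% X) x) (hY : MDiffAt (T% Y) x) :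
    extDerivOne (S.eta i) X Y x = 2 * S.nablaXi i x (X x) (Y x) := by
  rw [S.extDerivOne_eta (isMetricConnection_leviCivita S.g) i hX hY, torsion_leviCivita]
  have h := nablaXi_swap hK i x (X x) (Y x)
  simp only [nablaXi] at h ⊢
  simp only [Pi.zero_apply, zero_apply, map_zero]
  linarith

lemma nablaXi_phi_phi (hN : S.IsNormal) (hK : ∀ i, IsKilling S.g (S.xi i))
    (i : Fin s) (x : M) (u v : TangentSpace I x) :
    S.nablaXi i x (S.phi x u) (S.phi x v) = S.nablaXi i x u v := by
  have hX := mdifferentiableAt_extend I E u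
  have hY := mdifferentiableAt_extend I E v
  have h := extDerivOne_phiField_phiField hN i hX hY
  rw [extDerivOne_eta_eq_nablaXi hK i hX hY, extDerivOne_eta_eq_nablaXi hK i
    (S.mdifferentiableAt_phiField hX) (S.mdifferentiableAt_phiField hY)] at h
  simp only [GloballyFramedFStructure.phiField, extend_apply_self] at h
  linarith

lemma nablaXi_xi_right (hN : S.IsNormal) (hK : ∀ i, IsKilling S.g (S.xi i))
    (i j : Fin s) (x : M) (u : TangentSpace I x) :
    S.nablaXi i x u (S.xi j x) = 0 := by
  have hX := mdifferentiableAt_extend I E u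
  have h := extDerivOne_xi_right hN i j hX
  rw [extDerivOne_eta_eq_nablaXi hK i hX (S.mdifferentiableAt_xi j x), extend_apply_self] at h
  linarith

lemma leviCivita_xi_xi (hN : S.IsNormal) (hK : ∀ i, IsKilling S.g (S.xi i))
    (i j : Fin s) (x : M) :
    leviCivita S.g (S.xi i) x (S.xi j x) = 0 := by
  refine eq_of_inner_eq S.g fun u ↦ ?_
  have h := nablaXi_xi_right hN hK i j x u
  rw [nablaXi_swap hK, nablaXi, neg_eq_zero] at h
  rw [h, map_zero, zero_apply]

lemma frameCorrection_xi (hN : S.IsNormal) (hK : ∀ i, IsKilling S.g (S.xi i))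
    (j : Fin s) (x : M) (u : TangentSpace I x) :
    S.frameCorrection x (S.xi j x) u = -leviCivita S.g (S.xi j) x u := by
  simp [frameCorrection_apply, leviCivita_xi_xi hN hK, nablaXi_xi_right hN hK, S.eta_xi]

lemma frameConnection_xi (hN : S.IsNormal) (hK : ∀ i, IsKilling S.g (S.xi i))
    (j : Fin s) (x : M) (u : TangentSpace I x) :
    S.frameConnection (S.xi j) x u = 0 := by
  rw [frameConnection, addOneForm_apply, frameCorrection_xi hN hK, add_neg_cancel]

lemma inner_frameCorrection_swap_right (hK : ∀ i, IsKilling S.g (S.xi i))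
    (x : M) (u v w : TangentSpace I x) :
    S.g.inner x (S.frameCorrection x v u) w = -S.g.inner x (S.frameCorrection x w u) v := by
  rw [inner_frameCorrection, inner_frameCorrection, ← Finset.sum_neg_distrib]
  refine Finset.sum_congr rfl fun i _ ↦ ?_
  rw [nablaXi_swap hK i x w v]
  ring

lemma frameCorrection_swap (hK : ∀ i, IsKilling S.g (S.xi i))
    (x : M) (u v : TangentSpace I x) :
    S.frameCorrection x v u = -S.frameCorrection x u v := by
  rw [frameCorrection_apply, frameCorrection_apply, ← Finset.sum_neg_distrib]
  refine Finset.sum_congr rfl fun i _ ↦ ?_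
  rw [nablaXi_swap hK i x u v]
  module

lemma isMetricConnection_frameConnection (hK : ∀ i, IsKilling S.g (S.xi i)) :
    IsMetricConnection S.g S.frameConnection :=
  (isMetricConnection_leviCivita S.g).addOneForm (inner_frameCorrection_swap_right hK)

lemma torsion_frameConnection (hK : ∀ i, IsKilling S.g (S.xi i))
    (x : M) (u v : TangentSpace I x) :
    S.frameConnection.torsion x u v = (2 : ℝ) • S.frameCorrection x v u := by
  rw [frameConnection, torsion_addOneForm, torsion_leviCivita, frameCorrection_swap hK x v u]
  simp only [Pi.zero_apply, zero_apply]
  module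

/-- The form `∑ η_i ∧ dη_i` has the symmetry of the torsion of a connection with `∇φ = 0`. -/
lemma inner_frameCorrection_phi (hN : S.IsNormal) (hK : ∀ i, IsKilling S.g (S.xi i))
    (x : M) (u v w : TangentSpace I x) :
    S.g.inner x (S.frameCorrection x v u) w =
      S.g.inner x (S.frameCorrection x (S.phi x v) (S.phi x u)) w
        + S.g.inner x (S.frameCorrection x (S.phi x v) u) (S.phi x w)
        + S.g.inner x (S.frameCorrection x v (S.phi x u)) (S.phi x w) := by
  simp only [inner_frameCorrection, ← Finset.sum_add_distrib]
  refine Finset.sum_congr rfl fun i _ ↦ ?_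
  simp only [S.eta_phi, nablaXi_phi_phi hN hK]
  ring

lemma eta_frameCorrection (hN : S.IsNormal) (hK : ∀ i, IsKilling S.g (S.xi i))
    (i : Fin s) (x : M) (u v : TangentSpace I x) :
    S.eta i x (S.frameCorrection x v u) = S.nablaXi i x u v := by
  rw [← S.inner_xi_right, inner_frameCorrection]
  simp [nablaXi_xi_right hN hK, S.eta_xi]

lemma nablaPhi_xi (hN : S.IsNormal) (hK : ∀ i, IsKilling S.g (S.xi i))
    (j : Fin s) (x : M) (u : TangentSpace I x) :
    S.nablaPhi x (S.xi j x) u = 0 := by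
  rw [nablaPhi_apply (S.mdifferentiableAt_xi j x), S.phiField_xi, frameConnection_xi hN hK]
  simp

lemma eta_frameConnection_phiField (hN : S.IsNormal) (hK : ∀ i, IsKilling S.g (S.xi i))
    (i : Fin s) {X : ∀ x : M, TangentSpace I x} {x : M}
    (hX : MDiffAt (T% X) x) (u : TangentSpace I x) :
    S.eta i x (S.frameConnection (S.phiField X) x u) = 0 := by
  have h := isMetricConnection_frameConnection hK x (S.xi i) (S.phiField X) u
    (S.mdifferentiableAt_xi i x) (S.mdifferentiableAt_phiField hX)
  simp only [S.inner_xi_left, frameConnection_xi hN hK, mvfderiv_eta_phiField, map_zero] at h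
  simpa using h.symm

/-- `∇φ` anticommutes with `φ`, because `φ²` is parallel. It is enough to check this on the `ξ_j`,
where both sides vanish, and on vectors `φ v`. -/
lemma nablaPhi_phi (hN : S.IsNormal) (hK : ∀ i, IsKilling S.g (S.xi i))
    (x : M) (u v : TangentSpace I x) :
    S.nablaPhi x (S.phi x v) u = -S.phi x (S.nablaPhi x v u) := by
  have hphi (v : TangentSpace I x) :
      S.nablaPhi x (S.phi x (S.phi x v)) u = -S.phi x (S.nablaPhi x (S.phi x v) u) := by
    have hX := mdifferentiableAt_extend I E v
    have hX' := S.mdifferentiableAt_phiField hX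
    have h1 := nablaPhi_apply (S := S) hX' u
    have h2 := nablaPhi_apply (S := S) (S.mdifferentiableAt_phiField hX') u
    have h3 : S.phiField (S.phiField (S.phiField (extend E v))) =
        (-1 : ℝ) • S.phiField (extend E v) := by
      funext y
      have := S.phi_cube y (extend E v y)
      simp only [GloballyFramedFStructure.phiField, Pi.smul_apply, neg_smul, one_smul]
      exact eq_neg_of_add_eq_zero_left this
    rw [h3, S.frameConnection.isCovariantDerivativeOnUniv.smul_const (-1) hX'] at h2
    simp only [GloballyFramedFStructure.phiField, extend_apply_self] at h1 h2
    rw [h1, h2, map_sub, S.phi_sq x (S.frameConnection _ x u)]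
    have h4 (i : Fin s) := eta_frameConnection_phiField hN hK i hX u
    simp only [h4, smul_apply]
    simp
    abel
  have hv : v = -S.phi x (S.phi x v) + ∑ k, S.eta k x v • S.xi k x := by
    rw [S.phi_sq]; abel
  have hP : S.nablaPhi x v u = -S.nablaPhi x (S.phi x (S.phi x v)) u := by
    conv_lhs => rw [hv]
    simp only [map_add, map_neg, map_sum, map_smul, add_apply, neg_apply, sum_apply, smul_apply,
      nablaPhi_xi hN hK, smul_zero, Finset.sum_const_zero, add_zero]
  have h5 : S.phi x v = -S.phi x (S.phi x (S.phi x v)) :=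
    eq_neg_of_add_eq_zero_right (S.phi_cube x v)
  rw [hP, map_neg, ← hphi, ← neg_apply, ← map_neg, ← h5]

lemma inner_nablaPhi_phi (hN : S.IsNormal) (hK : ∀ i, IsKilling S.g (S.xi i))
    (x : M) (u v w : TangentSpace I x) :
    S.g.inner x (S.nablaPhi x (S.phi x v) u) w = S.g.inner x (S.nablaPhi x v u) (S.phi x w) := by
  rw [nablaPhi_phi hN hK, map_neg, neg_apply, S.inner_phi_left, neg_neg]

end KillingNormal

end MetricFStructure

/-! ### Existence -/

namespace MetricFStructure

variable {E : Type*} [NormedAddCommGroup E] [NormedSpace ℝ E] [FiniteDimensional ℝ E]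
  {H : Type*} [TopologicalSpace H] {I : ModelWithCorners ℝ E H}
  {M : Type*} [TopologicalSpace M] [ChartedSpace H M] [IsManifold I ∞ M] {n s : ℕ}

section SkewCorrection

variable (S : MetricFStructure I M n s)

/-- The form `B(u, v, w) = -(p(φu, v, w) + p(φv, w, u) + p(φw, u, v))` with
`p(u, v, w) = g((∇_u φ) v, w)`, where `∇` is `frameConnection`. -/
def skewForm (x : M) (u v w : TangentSpace I x) : ℝ :=
  -(S.g.inner x (S.nablaPhi x v (S.phi x u)) w + S.g.inner x (S.nablaPhi x w (S.phi x v)) u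
    + S.g.inner x (S.nablaPhi x u (S.phi x w)) v)

/-- The covector `-B(u, v, ·)`, in a form that uses `p(φv, w, u) = -p(φv, u, w)`. -/
def skewCovector (x : M) (v u : TangentSpace I x) : TangentSpace I x →L[ℝ] ℝ :=
  S.g.inner x (S.nablaPhi x v (S.phi x u)) - S.g.inner x (S.nablaPhi x u (S.phi x v))
    + (S.g.inner x v) ∘L (S.nablaPhi x u) ∘L (S.phi x)

lemma skewCovector_apply (x : M) (v u w : TangentSpace I x) :
    S.skewCovector x v u w = S.g.inner x (S.nablaPhi x v (S.phi x u)) w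
      - S.g.inner x (S.nablaPhi x u (S.phi x v)) w
      + S.g.inner x v (S.nablaPhi x u (S.phi x w)) :=
  rfl

/-- The endomorphism-valued 1-form `C` with `g(C_u v, w) = B(u, v, w) / 2`, as the bilinear map
`(v, u) ↦ C_u v`. -/
def skewCorrection (x : M) :
    TangentSpace I x →L[ℝ] TangentSpace I x →L[ℝ] TangentSpace I x :=
  (LinearMap.mk₂ ℝ
    (fun v u : TangentSpace I x ↦ (-1 / 2 : ℝ) • sharp S.g x (S.skewCovector x v u))
    (fun v v' u ↦ by
      rw [← smul_add, ← map_add]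
      congr 2
      ext w
      simp only [skewCovector_apply, map_add, add_apply]
      ring)
    (fun c v u ↦ by
      rw [smul_comm c, ← map_smul (sharp S.g x) c]
      congr 2
      ext w
      simp only [skewCovector_apply, map_smul, smul_apply, smul_eq_mul]
      ring)
    (fun v u u' ↦ by
      rw [← smul_add, ← map_add]
      congr 2
      ext w
      simp only [skewCovector_apply, map_add, add_apply]
      ring)
    (fun c v u ↦ by
      rw [smul_comm c, ← map_smul (sharp S.g x) c]
      congr 2
      ext w
      simp only [skewCovector_apply, map_smul, smul_apply, smul_eq_mul]
      ring)).toContinuousBilinearMap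

/-- The connection `∇^g + (1/2) (∑ η_i ∧ dη_i + B)`. -/
def skewConnection : CovariantDerivative I E (fun x : M ↦ TangentSpace I x) :=
  S.frameConnection.addOneForm S.skewCorrection

end SkewCorrection

variable {S : MetricFStructure I M n s}

lemma inner_nablaPhi_swap (hK : ∀ i, IsKilling S.g (S.xi i)) (x : M) (u v w : TangentSpace I x) :
    S.g.inner x (S.nablaPhi x v u) w = -S.g.inner x (S.nablaPhi x w u) v :=
  S.inner_phiDeriv_swap (isMetricConnection_frameConnection hK) u v w

lemma inner_skewCorrection (hK : ∀ i, IsKilling S.g (S.xi i)) (x : M) (u v w : TangentSpace I x) :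
    S.g.inner x (S.skewCorrection x v u) w = (1 / 2) * S.skewForm x u v w := by
  have h : S.skewCorrection x v u = (-1 / 2 : ℝ) • sharp S.g x (S.skewCovector x v u) := rfl
  rw [h, map_smul, smul_apply, smul_eq_mul, inner_sharp, skewCovector_apply, skewForm,
    inner_nablaPhi_swap hK x (S.phi x v) w u, S.g.symm x v]
  ring

lemma skewForm_swap_right (hK : ∀ i, IsKilling S.g (S.xi i)) (x : M) (u v w : TangentSpace I x) :
    S.skewForm x u v w = -S.skewForm x u w v := by
  rw [skewForm, skewForm, inner_nablaPhi_swap hK x (S.phi x u) v w,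
    inner_nablaPhi_swap hK x (S.phi x v) w u, inner_nablaPhi_swap hK x (S.phi x w) u v]
  ring

lemma skewForm_swap_left (hK : ∀ i, IsKilling S.g (S.xi i)) (x : M) (u v w : TangentSpace I x) :
    S.skewForm x u v w = -S.skewForm x v u w := by
  rw [skewForm, skewForm, inner_nablaPhi_swap hK x (S.phi x u) v w,
    inner_nablaPhi_swap hK x (S.phi x v) w u, inner_nablaPhi_swap hK x (S.phi x w) u v]
  ring

lemma isSmoothConnection_skewConnection (hK : ∀ i, IsKilling S.g (S.xi i)) :
    IsSmoothConnection S.g S.skewConnection := by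
  have hp {x : M} {X Y Z : ∀ x : M, TangentSpace I x} (hX : CMDiffAt ∞ (T% X) x)
      (hY : CMDiffAt ∞ (T% Y) x) (hZ : CMDiffAt ∞ (T% Z) x) :
      CMDiffAt ∞ (fun y ↦ S.g.inner y (S.nablaPhi y (Y y) (S.phi y (X y))) (Z y)) x := by
    have hF := isSmoothConnection_frameConnection S
    have hX' := S.contMDiffAt_phiField hX
    refine ((hF x _ _ Z hX' (S.contMDiffAt_phiField hY) hZ).add
      (hF x _ Y _ hX' hY (S.contMDiffAt_phiField hZ))).congr_of_eventuallyEq ?_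
    filter_upwards [eventually_mdifferentiableAt hY] with y hY
    rw [nablaPhi_apply hY, map_sub, sub_apply, S.inner_phi_left]
    simp only [GloballyFramedFStructure.phiField, sub_neg_eq_add, Pi.add_apply]
  refine (isSmoothConnection_frameConnection S).addOneForm fun x X Y Z hX hY hZ ↦ ?_
  simp only [inner_skewCorrection hK, skewForm]
  exact contMDiffAt_const.mul (((hp hX hY hZ).add (hp hY hZ hX)).add (hp hZ hX hY)).neg

lemma isMetricConnection_skewConnection (hK : ∀ i, IsKilling S.g (S.xi i)) :
    IsMetricConnection S.g S.skewConnection :=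
  (isMetricConnection_frameConnection hK).addOneForm fun x u v w ↦ by
    rw [inner_skewCorrection hK, inner_skewCorrection hK, skewForm_swap_right hK]
    ring

lemma inner_torsion_skewConnection (hK : ∀ i, IsKilling S.g (S.xi i)) (x : M)
    (u v w : TangentSpace I x) :
    S.g.inner x (S.skewConnection.torsion x u v) w =
      2 * S.g.inner x (S.frameCorrection x v u) w + S.skewForm x u v w := by
  rw [skewConnection, torsion_addOneForm, torsion_frameConnection hK]
  simp only [map_add, map_sub, map_smul, add_apply, sub_apply, smul_apply, smul_eq_mul,
    inner_skewCorrection hK]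
  rw [skewForm_swap_left hK x v u]
  ring

lemma hasSkewTorsion_skewConnection (hK : ∀ i, IsKilling S.g (S.xi i)) :
    HasSkewTorsion S.g S.skewConnection := by
  intro x u v w
  simp only [inner_torsion_skewConnection hK]
  constructor
  · rw [frameCorrection_swap hK, skewForm_swap_left hK x v u, map_neg, neg_apply]
    ring
  · rw [inner_frameCorrection_swap_right hK, skewForm_swap_right hK x u w v]
    ring

/-- The part of `N⁽¹⁾ = 0` that is linear in `∇φ`: the torsion of `frameConnection` does not
contribute, by `inner_frameCorrection_phi`. -/
lemma inner_nablaPhi_phi_add (hN : S.IsNormal) (hK : ∀ i, IsKilling S.g (S.xi i)) (x : M)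
    (u v w : TangentSpace I x) :
    S.g.inner x (S.nablaPhi x v (S.phi x u)) w + S.g.inner x (S.nablaPhi x v u) (S.phi x w) =
      S.g.inner x (S.nablaPhi x u (S.phi x v)) w
        + S.g.inner x (S.nablaPhi x u v) (S.phi x w) := by
  have hX := mdifferentiableAt_extend I E u
  have hY := mdifferentiableAt_extend I E v
  have hnij := congr(S.g.inner x $(hN x _ _ hX hY) w)
  rw [S.nijenhuis_eq (cov := S.frameConnection) hX hY] at hnij
  simp only [torsion_frameConnection hK, extDerivOne_eta_eq_nablaXi hK _ hX hY, extend_apply_self,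
    map_zero, map_add, map_sub, map_smul, add_apply, sub_apply, smul_apply, zero_apply,
    inner_phi_phi_left, S.inner_sum_xi, eta_frameCorrection hN hK, smul_eq_mul] at hnij
  simp only [S.inner_phi_left, mul_assoc, ← Finset.mul_sum] at hnij
  have h := inner_frameCorrection_phi hN hK x u v w
  simp only [nablaPhi]
  linarith

/-- `(∇_{φu} φ) v = φ ((∇_u φ) v)`: the difference, as a trilinear form, is symmetric in its first
two arguments and skew-symmetric in the last two. -/
lemma inner_nablaPhi_phi_left (hN : S.IsNormal) (hK : ∀ i, IsKilling S.g (S.xi i)) (x : M)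
    (u v w : TangentSpace I x) :
    S.g.inner x (S.nablaPhi x v (S.phi x u)) w = -S.g.inner x (S.nablaPhi x v u) (S.phi x w) := by
  have symm := inner_nablaPhi_phi_add hN hK x
  have skew (u v w : TangentSpace I x) :
      S.g.inner x (S.nablaPhi x v (S.phi x u)) w + S.g.inner x (S.nablaPhi x v u) (S.phi x w) =
        -(S.g.inner x (S.nablaPhi x w (S.phi x u)) v
          + S.g.inner x (S.nablaPhi x w u) (S.phi x v)) := by
    rw [inner_nablaPhi_swap hK x _ v w, inner_nablaPhi_swap hK x u v, inner_nablaPhi_phi hN hK]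
    ring
  linarith [symm u v w, skew v u w, symm v w u, skew w v u, symm w u v, skew u w v]

lemma inner_nablaPhi_xi (hN : S.IsNormal) (hK : ∀ i, IsKilling S.g (S.xi i)) (i : Fin s) (x : M)
    (u v : TangentSpace I x) : S.g.inner x (S.nablaPhi x v u) (S.xi i x) = 0 := by
  rw [inner_nablaPhi_swap hK, nablaPhi_xi hN hK, map_zero, zero_apply, neg_zero]

lemma inner_nablaPhi_phi_phi (hN : S.IsNormal) (hK : ∀ i, IsKilling S.g (S.xi i)) (x : M)
    (u v w : TangentSpace I x) :
    S.g.inner x (S.nablaPhi x v u) (S.phi x (S.phi x w)) = -S.g.inner x (S.nablaPhi x v u) w := by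
  rw [S.phi_sq]
  simp [inner_nablaPhi_xi hN hK]

lemma skewForm_xi (hN : S.IsNormal) (hK : ∀ i, IsKilling S.g (S.xi i)) (i : Fin s) (x : M)
    (u w : TangentSpace I x) : S.skewForm x u (S.xi i x) w = 0 := by
  simp [skewForm, nablaPhi_xi hN hK, S.phi_xi, inner_nablaPhi_xi hN hK]

lemma skewConnection_xi (hN : S.IsNormal) (hK : ∀ i, IsKilling S.g (S.xi i)) (i : Fin s) (x : M)
    (u : TangentSpace I x) : S.skewConnection (S.xi i) x u = 0 := by
  rw [skewConnection, addOneForm_apply, frameConnection_xi hN hK, zero_add]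
  refine eq_of_inner_eq S.g fun w ↦ ?_
  rw [inner_skewCorrection hK, skewForm_xi hN hK, map_zero, zero_apply, mul_zero]

/-- `B` compensates for `∇φ`. -/
lemma skewForm_phi_add (hN : S.IsNormal) (hK : ∀ i, IsKilling S.g (S.xi i)) (x : M)
    (u v w : TangentSpace I x) :
    S.skewForm x u (S.phi x v) w + S.skewForm x u v (S.phi x w) =
      -2 * S.g.inner x (S.nablaPhi x v u) w := by
  simp only [skewForm, inner_nablaPhi_phi_left hN hK, inner_nablaPhi_phi hN hK,
    inner_nablaPhi_phi_phi hN hK]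
  ring

/-- If the `ξ_i` of a normal metric `f`-structure are Killing, then `skewConnection` is an almost
metric `φ`-connection with skew-torsion. -/
lemma isSkewPhiConnection_skewConnection (hN : S.IsNormal) (hK : ∀ i, IsKilling S.g (S.xi i)) :
    S.IsSkewPhiConnection S.skewConnection where
  left :=
    { smooth := (isSmoothConnection_skewConnection hK).contMDiffCovariantDerivative
      metric := isMetricConnection_skewConnection hK
      parallel_phi := fun x Y u hY ↦ by
        refine eq_of_inner_eq S.g fun w ↦ ?_
        have h1 := congr(S.g.inner x $(nablaPhi_apply (S := S) hY u) w)
        have h2 := skewForm_phi_add hN hK x u (Y x) w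
        simp only [skewConnection, addOneForm_apply, map_add, map_sub, add_apply, sub_apply,
          S.inner_phi_left, inner_skewCorrection hK] at h1 ⊢
        simp only [GloballyFramedFStructure.phiField]
        linarith
      parallel_xi := skewConnection_xi hN hK
      parallel_eta := fun i x Y v hY ↦ by
        have h := isMetricConnection_skewConnection hK x (S.xi i) Y v
          (S.mdifferentiableAt_xi i x) hY
        simpa only [S.inner_xi_left, skewConnection_xi hN hK, map_zero, zero_apply, zero_add]
          using h }
  right := hasSkewTorsion_skewConnection hK

lemma isUniqueSkewPhiConnection_skewConnection (hN : S.IsNormal)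
    (hK : ∀ i, IsKilling S.g (S.xi i)) : S.IsUniqueSkewPhiConnection S.skewConnection :=
  ⟨isSkewPhiConnection_skewConnection hN hK, fun _ h' ↦
    (isSkewPhiConnection_skewConnection hN hK).sameConnection hN h'⟩

end MetricFStructure

end MetricF

end

theorem mainTheorem8
    {E : Type*} [NormedAddCommGroup E] [NormedSpace ℝ E] [FiniteDimensional ℝ E]
    {H : Type*} [TopologicalSpace H] (I : ModelWithCorners ℝ E H) [I.Boundaryless]
    (M : Type*) [TopologicalSpace M] [ChartedSpace H M] [IsManifold I ∞ M]
    [T2Space M] [SecondCountableTopology M]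
    (n s : ℕ) (S : MetricF.MetricFStructure I M n s) :
    (S.IsNormal →
      ((∃ cov : CovariantDerivative I E (fun x : M ↦ TangentSpace I x),
          S.IsUniqueSkewPhiConnection cov) ↔
        ∀ i : Fin s, MetricF.IsKilling S.g (S.xi i)) ∧
      (∀ cov : CovariantDerivative I E (fun x : M ↦ TangentSpace I x),
        S.IsSkewPhiConnection cov →
        ∀ (x : M) (X Y Z : ∀ x : M, TangentSpace I x),
          MDiffAt (T% X) x → MDiffAt (T% Y) x → MDiffAt (T% Z) x →
          S.g.inner x (cov.torsion x (X x) (Y x)) (Z x) =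
            (∑ i, MetricF.wedgeExtDeriv (S.eta i) X Y Z x) + S.dPhiFundForm X Y Z x)) ∧
    (1 ≤ s → S.IsKStructure →
      ∃ D cov : CovariantDerivative I E (fun x : M ↦ TangentSpace I x),
        MetricF.IsLeviCivita S.g D ∧
        S.IsUniqueSkewPhiConnection cov ∧
        ∀ (x : M) (X Y Z : ∀ x : M, TangentSpace I x),
          MDiffAt (T% X) x → MDiffAt (T% Y) x → MDiffAt (T% Z) x →
          S.g.inner x (cov Y x (X x)) (Z x) =
            S.g.inner x (D Y x (X x)) (Z x) +
              (1 / 2) * ∑ j, MetricF.wedgeExtDeriv (S.eta j) X Y Z x) := by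
  refine ⟨fun hN ↦ ⟨⟨fun ⟨cov, h, _⟩ i ↦ h.isKilling i, fun hK ↦
    ⟨S.skewConnection, S.isUniqueSkewPhiConnection_skewConnection hN hK⟩⟩,
    fun cov h x X Y Z hX hY hZ ↦ h.inner_torsion hN hX hY hZ⟩, fun _ h ↦ ?_⟩
  have hu := S.isUniqueSkewPhiConnection_skewConnection h.normal h.isKilling
  refine ⟨MetricF.leviCivita S.g, S.skewConnection, MetricF.isLeviCivita_leviCivita S.g, hu,
    fun x X Y Z hX hY hZ ↦ ?_⟩
  rw [MetricF.inner_eq_leviCivita_add_torsion (MetricF.isMetricConnection_leviCivita S.g)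
    (MetricF.torsion_leviCivita S.g) hu.1.1.metric hu.1.2 hX hY hZ,
    hu.1.inner_torsion h.normal hX hY hZ, h.dPhiFundForm_eq_zero hX hY hZ, add_zero]
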